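/- Let $\mathbb{T}$ be the infinite random recursive tree on $\mathbb{N}=\{1,2,\dots\}$: vertex $1$ is the root and, for every $i\ge 2$, the parent $u_i$ of $i$ is uniform on $\{1,\dots,i-1\}$, independently of the other vertices. Let $(\epsilon_i)_{i\ge 2}$ be i.i.d. standard exponential variables, independent of $\mathbb{T}$, and for $t\ge 0$ let $\Pi(t)=(\Pi_1(t),\Pi_2(t),\dots)$ be the partition of $\mathbb{N}$ into the connected components of the forest obtained from $\mathbb{T}$ by removing every edge $\{i,u_i\}$ with $\epsilon_i\le t$; the blocks are listed in increasing order of their smallest elements (followed by empty blocks if there are only finitely many). Then for all $t\ge 0$ and $i\in\mathbb{N}$ the weight $$X_i(t)=\lim_{n\to\infty} n^{-e^{-t}}\,\#\{j\le n : j\in\Pi_i(t)\}$$ exists (as a finite limit) almost surely, and, as $t\to\infty$, $$(X_i(t): i\in\mathbb{N}) \Longrightarrow (W_i : i\in\mathbb{N})$$ in distribution on $\mathbb{R}^{\mathbb{N}}$ with the product topology (equivalently, in the sense of finite-dimensional distributions), where the $W_i$ are i.i.d. standard exponential variables. -/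

import Mathlib

open MeasureTheory ProbabilityTheory Filter Topology
open scoped NNReal

namespace RecursiveTree

/-- The random data of an infinite random recursive tree whose edges carry independent standard
exponential clocks. Vertices are the natural numbers `0, 1, 2, …`, the vertex `k` being the one
with label `k + 1`, so that `0` is the root. For every `k`, `u k` is the parent of the vertex
`k + 1`, uniform on the `k + 1` previous vertices `{0, …, k}`, and `ε k` is the time at which the
edge joining `k + 1` to `u k` is removed. -/
structure IsDestruction {Ω : Type*} [MeasurableSpace Ω] (P : Measure Ω)
    (u : ℕ → Ω → ℕ) (ε : ℕ → Ω → ℝ) : Prop where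
  measurable_parent : ∀ k, Measurable (u k)
  measurable_clock : ∀ k, Measurable (ε k)
  law_parent : ∀ k, HasLaw (u k) (uniformOn (Set.Iic k)) P
  law_clock : ∀ k, HasLaw (ε k) (expMeasure 1) P
  indep_parent : iIndepFun u P
  indep_clock : iIndepFun ε P
  indep_parent_clock : IndepFun (fun ω k ↦ u k ω) (fun ω k ↦ ε k ω) P

/-- The forest left at time `t`: the edge between `k + 1` and its parent `u k` is still present
exactly when its removal time `ε k` is larger than `t`. -/
def forest (u : ℕ → ℕ) (ε : ℕ → ℝ) (t : ℝ≥0) : SimpleGraph ℕ :=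
  SimpleGraph.fromRel fun i j ↦ ∃ k, i = k + 1 ∧ j = u k ∧ (t : ℝ) < ε k

/-- The partition `Π(t)` of the vertex set into the connected components of the forest at
time `t`, as an equivalence relation. -/
def partition (u : ℕ → ℕ) (ε : ℕ → ℝ) (t : ℝ≥0) : Setoid ℕ :=
  (forest u ε t).reachableSetoid

/-- `m` is the smallest element of its block in the partition `r`. -/
def IsBlockMin (r : Setoid ℕ) (m : ℕ) : Prop :=
  ∀ j, r m j → m ≤ j

open Classical in
/-- The block number `i` (`i = 0, 1, …`) of the partition `r` when the blocks are listed in the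
increasing order of their smallest elements: its smallest element `m` is a block minimum with
exactly `i` smaller block minima. It is empty if there are at most `i` blocks. -/
noncomputable def block (r : Setoid ℕ) (i : ℕ) : Set ℕ :=
  {j | ∃ m, IsBlockMin r m ∧ Nat.count (IsBlockMin r) m = i ∧ r m j}

open Classical in
/-- The number of vertices of `B` among the first `n` vertices, multiplied by `n ^ (-e ^ (-t))`. -/
noncomputable def scaledCount (B : Set ℕ) (t : ℝ≥0) (n : ℕ) : ℝ :=
  (n : ℝ) ^ (-Real.exp (-(t : ℝ))) * (Nat.count (· ∈ B) n : ℝ)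

/-- The weight of the block number `i` of the partition at time `t`, that is the limit of the
scaled counts (an arbitrary value if the limit does not exist). -/
noncomputable def weight (u : ℕ → ℕ) (ε : ℕ → ℝ) (t : ℝ≥0) (i : ℕ) : ℝ :=
  limUnder atTop (scaledCount (block (partition u ε t) i) t)

end RecursiveTree

/-! Put p = e^{-t}. Given the tree on the first n vertices, the next vertex joins a block of size S
with probability p S / n. Weight a block by R(z, S) = Γ(S + z) / (Γ(S) Γ(1 + z)), whose relative
increase at a new vertex is z / S: the factor S cancels, and the product of R(z_i, S_i) over several
blocks grows in conditional mean by the factor 1 + p (∑ z_i) / n, whatever the sizes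
(`setIntegral_sizeProd_succ`). Dividing by R(p ∑ z_i, n) gives a martingale when this ratio does not
vanish, and R(z, n) ~ n^z / Γ(1 + z) (`tendsto_risingRatio`).

Three choices of exponent suffice. With z = 1 the martingale is essentially n^{-p} S, so weights
exist. With z = -1/2 it bounds S^{-1/2} n^{p/2} along almost every path, so the weight of an
existing block is positive. With z_j = iθ_j the products are bounded, and dominated convergence
gives the exact joint Mellin transform of the first N weights on the event that the first N vertices
lie in distinct blocks (`setIntegral_exp_log_weight`).

As t → ∞ this event has probability tending to 1 and p ∑ θ_j → 0, so only ∏ Γ(1 + iθ_j) remains: the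
characteristic function of the logarithms of independent standard exponentials. Lévy's theorem,
exponentiation and truncation to finitely many coordinates conclude. -/

namespace RecursiveTree

/-! ### Blocks, their top vertices and their sizes -/

section Combinatorics

/-- The top vertex of the block of a vertex in the forest at time `t`. -/
noncomputable def root (u : ℕ → ℕ) (ε : ℕ → ℝ) (t : ℝ≥0) : ℕ → ℕ
  | 0 => 0
  -- The test `u k ≤ k` only makes the recursion well founded; almost surely it always holds
  -- (`ae_parent_le`).
  | k + 1 => open Classical in if _h : (t : ℝ) < ε k ∧ u k ≤ k then root u ε t (u k) else k + 1
termination_by j => j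
decreasing_by omega

/-- The number of vertices among the first `n` whose block has top vertex `m`. -/
noncomputable def size (u : ℕ → ℕ) (ε : ℕ → ℝ) (t : ℝ≥0) (m n : ℕ) : ℕ :=
  Nat.count (root u ε t · = m) n

variable {u : ℕ → ℕ} {ε : ℕ → ℝ} {t : ℝ≥0}

lemma root_zero : root u ε t 0 = 0 := by rw [root]

lemma root_succ_of_lt {k : ℕ} (h : (t : ℝ) < ε k) (hu : u k ≤ k) :
    root u ε t (k + 1) = root u ε t (u k) := by rw [root, dif_pos ⟨h, hu⟩]

lemma root_succ_of_le {k : ℕ} (h : ε k ≤ t) : root u ε t (k + 1) = k + 1 := by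
  rw [root, dif_neg fun h' ↦ h.not_gt h'.1]

lemma root_le (j : ℕ) : root u ε t j ≤ j := by
  induction j using Nat.strong_induction_on with
  | _ j ih =>
    cases j with
    | zero => rw [root_zero]
    | succ k =>
      rw [root]
      split_ifs with h
      · exact (ih _ (by omega)).trans (by omega)
      · exact le_rfl

lemma reachable_root (j : ℕ) : (forest u ε t).Reachable j (root u ε t j) := by
  induction j using Nat.strong_induction_on with
  | _ j ih =>
    cases j with
    | zero => rw [root_zero]
    | succ k =>
      rw [root]
      split_ifs with h
      · refine SimpleGraph.Reachable.trans (SimpleGraph.Adj.reachable ?_) (ih (u k) (by omega))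
        rw [forest, SimpleGraph.fromRel_adj]
        exact ⟨by omega, Or.inl ⟨k, rfl, rfl, h.1⟩⟩
      · exact SimpleGraph.Reachable.refl _

lemma root_eq_of_adj (hu : ∀ k, u k ≤ k) {i j : ℕ} (h : (forest u ε t).Adj i j) :
    root u ε t i = root u ε t j := by
  rw [forest, SimpleGraph.fromRel_adj] at h
  obtain ⟨-, ⟨k, rfl, rfl, hk⟩ | ⟨k, rfl, rfl, hk⟩⟩ := h
  · exact root_succ_of_lt hk (hu k)
  · exact (root_succ_of_lt hk (hu k)).symm

lemma partition_iff (hu : ∀ k, u k ≤ k) {i j : ℕ} :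
    partition u ε t i j ↔ root u ε t i = root u ε t j := by
  change (forest u ε t).Reachable i j ↔ _
  refine ⟨?_, fun h ↦ ?_⟩
  · rintro ⟨w⟩
    induction w with
    | nil => rfl
    | cons h _ ih => exact (root_eq_of_adj hu h).trans ih
  · exact (reachable_root i).trans (h ▸ (reachable_root j).symm)

lemma root_root (hu : ∀ k, u k ≤ k) (j : ℕ) : root u ε t (root u ε t j) = root u ε t j :=
  ((partition_iff hu).1 (reachable_root j)).symm

lemma isBlockMin_iff (hu : ∀ k, u k ≤ k) {m : ℕ} :
    IsBlockMin (partition u ε t) m ↔ root u ε t m = m := by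
  refine ⟨fun h ↦ ?_, fun h j hj ↦ ?_⟩
  · exact le_antisymm (root_le m) (h _ (reachable_root m))
  · rw [partition_iff hu, h] at hj
    exact hj ▸ root_le j

open Classical in
lemma count_isBlockMin (hu : ∀ k, u k ≤ k) (m : ℕ) :
    Nat.count (IsBlockMin (partition u ε t)) m = Nat.count (fun j ↦ root u ε t j = j) m := by
  have : IsBlockMin (partition u ε t) = fun j ↦ root u ε t j = j :=
    funext fun m ↦ propext (isBlockMin_iff hu)
  simp_rw [this]

lemma mem_block_iff (hu : ∀ k, u k ≤ k) {i j : ℕ} :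
    j ∈ block (partition u ε t) i ↔ Nat.count (fun j ↦ root u ε t j = j) (root u ε t j) = i := by
  simp only [block, Set.mem_ofPred_eq, count_isBlockMin hu, isBlockMin_iff hu, partition_iff hu]
  refine ⟨fun ⟨m, h1, h2, h3⟩ ↦ ?_, fun h ↦ ⟨_, root_root hu j, h, root_root hu j⟩⟩
  rw [← h3, h1, h2]

lemma scaledCount_block (hu : ∀ k, u k ≤ k) {m : ℕ} (hm : root u ε t m = m) (n : ℕ) :
    scaledCount (block (partition u ε t) (Nat.count (fun j ↦ root u ε t j = j) m)) t n =
      (n : ℝ) ^ (-Real.exp (-(t : ℝ))) * size u ε t m n := by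
  have h : (· ∈ block (partition u ε t) (Nat.count (fun j ↦ root u ε t j = j) m)) =
      (root u ε t · = m) := by
    funext j
    refine propext ((mem_block_iff hu).trans ⟨fun h ↦ ?_, fun h ↦ by rw [h]⟩)
    exact Nat.count_injective (p := fun j ↦ root u ε t j = j) (root_root hu j) hm h
  rw [scaledCount, size]
  simp_rw [h]

lemma block_eq_empty (hu : ∀ k, u k ≤ k) {i : ℕ}
    (hi : ∀ m, root u ε t m = m → Nat.count (fun j ↦ root u ε t j = j) m ≠ i) :
    block (partition u ε t) i = ∅ := by
  refine Set.eq_empty_of_forall_notMem fun j hj ↦ ?_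
  exact hi _ (root_root hu j) ((mem_block_iff hu).1 hj)

lemma scaledCount_empty (n : ℕ) : scaledCount ∅ t n = 0 := by
  simp [scaledCount]

lemma size_succ (m n : ℕ) :
    size u ε t m (n + 1) = size u ε t m n + if root u ε t n = m then 1 else 0 :=
  Nat.count_succ _ _

lemma size_succ_eq_sum (m n : ℕ) :
    size u ε t m n = ∑ v ∈ Finset.range n, if root u ε t v = m then 1 else 0 := by
  rw [size, Nat.count_eq_card_filter_range, Finset.card_filter]

lemma size_le (m n : ℕ) : size u ε t m n ≤ n := Nat.count_le _

lemma size_pos_of_root_eq {v m n : ℕ} (h : root u ε t v = m) (hv : v < n) : 0 < size u ε t m n := by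
  rw [size, Nat.count_eq_card_filter_range, Finset.card_pos]
  exact ⟨v, by simp [h, hv]⟩

/-- Every value of `root` is fixed by `root`. Since `risingRatio` is 0 at size 0, products of rising
ratios then vanish as soon as one prescribed vertex is not the top of a block. -/
lemma size_eq_zero (hu : ∀ k, u k ≤ k) {m : ℕ} (hm : root u ε t m ≠ m) (n : ℕ) :
    size u ε t m n = 0 := by
  rw [size, Nat.count_eq_card_filter_range, Finset.card_eq_zero, Finset.filter_eq_empty_iff]
  intro v _ h
  exact hm (h ▸ root_root hu v)

/-- While the first `N` vertices are separate, each of their blocks has one vertex among them. -/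
lemma size_of_forall_root_eq {N m : ℕ} (hN : ∀ j < N, root u ε t j = j) (hm : m < N) :
    size u ε t m N = 1 := by
  rw [size_succ_eq_sum, Finset.sum_eq_single m]
  · rw [if_pos (hN m hm)]
  · intro b hb hbm
    rw [if_neg]
    rwa [hN b (Finset.mem_range.1 hb)]
  · simp [hm]

lemma size_add_two_of_le {n m : ℕ} (h : ε n ≤ t) (hm : m ≤ n) :
    size u ε t m (n + 2) = size u ε t m (n + 1) := by
  rw [size_succ, if_neg, add_zero]
  rw [root_succ_of_le h]
  omega

lemma size_add_two_of_lt {n m : ℕ} (h : (t : ℝ) < ε n) (hu : u n ≤ n) :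
    size u ε t m (n + 2) = size u ε t m (n + 1) + if root u ε t (u n) = m then 1 else 0 := by
  rw [size_succ, root_succ_of_lt h hu]

end Combinatorics

end RecursiveTree

namespace RecursiveTree

/-! ### Ratios of Gamma functions -/

section RisingRatio

variable {𝕜 : Type*} [RCLike 𝕜]

/-- The ratio `Γ(s + z) / (Γ(s) Γ(1 + z))` for `s ≥ 1`, extended by `0` to `s = 0`. -/
noncomputable def risingRatio (z : 𝕜) : ℕ → 𝕜
  -- This value makes a product vanish when one of its blocks is absent; the recursion
  -- `risingRatio_succ` starts only at size 1, the size of a newborn block.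
  | 0 => 0
  | s + 1 => ∏ k ∈ Finset.range s, (1 + z / ((k + 1 : ℕ) : 𝕜))

lemma risingRatio_zero_right (z : 𝕜) : risingRatio z 0 = 0 := rfl

lemma risingRatio_one (z : 𝕜) : risingRatio z 1 = 1 := by simp [risingRatio]

lemma risingRatio_succ (z : 𝕜) {s : ℕ} (hs : s ≠ 0) :
    risingRatio z (s + 1) = risingRatio z s * (1 + z / (s : 𝕜)) := by
  obtain ⟨s, rfl⟩ := Nat.exists_eq_succ_of_ne_zero hs
  simp only [risingRatio, Finset.prod_range_succ]

lemma norm_risingRatio_le (z : 𝕜) {s n : ℕ} (hs : s ≤ n) :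
    ‖risingRatio z s‖ ≤ (1 + ‖z‖) ^ n := by
  have h1 : 1 ≤ 1 + ‖z‖ := by simp
  refine le_trans ?_ (pow_le_pow_right₀ h1 hs)
  cases s with
  | zero => simp [risingRatio]
  | succ s =>
    refine le_trans ?_ (pow_le_pow_right₀ h1 s.le_succ)
    rw [risingRatio, norm_prod, ← Finset.card_range s, ← Finset.prod_const, Finset.card_range]
    refine Finset.prod_le_prod (fun _ _ ↦ norm_nonneg _) fun k _ ↦ (norm_add_le _ _).trans ?_
    rw [norm_one, norm_div, RCLike.norm_natCast]
    gcongr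
    exact div_le_self (norm_nonneg _) (by simp)

lemma risingRatio_one_left (s : ℕ) : risingRatio (1 : 𝕜) s = s := by
  induction s with
  | zero => simp [risingRatio]
  | succ s ih =>
    rcases eq_or_ne s 0 with rfl | hs
    · simp [risingRatio]
    · rw [risingRatio_succ _ hs, ih]
      have : (s : 𝕜) ≠ 0 := by exact_mod_cast hs
      field_simp
      push_cast
      ring

lemma risingRatio_zero_left {s : ℕ} (hs : s ≠ 0) : risingRatio (0 : 𝕜) s = 1 := by
  obtain ⟨s, rfl⟩ := Nat.exists_eq_succ_of_ne_zero hs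
  simp [risingRatio]

lemma continuous_risingRatio (s : ℕ) : Continuous fun z : 𝕜 ↦ risingRatio z s := by
  cases s with
  | zero => simpa [risingRatio] using continuous_const
  | succ s => simp only [risingRatio]; fun_prop

lemma risingRatio_pos {z : ℝ} (hz : -1 < z) {s : ℕ} (hs : s ≠ 0) : 0 < risingRatio z s := by
  obtain ⟨s, rfl⟩ := Nat.exists_eq_succ_of_ne_zero hs
  refine Finset.prod_pos fun k _ ↦ ?_
  have : (0 : ℝ) < (k + 1 : ℕ) := by positivity
  have h2 : (1 : ℝ) ≤ (k + 1 : ℕ) := by simp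
  have : 1 + z / (k + 1 : ℕ) = ((k + 1 : ℕ) + z) / (k + 1 : ℕ) := by field_simp
  rw [this]
  apply div_pos <;> linarith

lemma risingRatio_nonneg {z : ℝ} (hz : -1 < z) (s : ℕ) : 0 ≤ risingRatio z s := by
  rcases eq_or_ne s 0 with rfl | hs
  · simp [risingRatio]
  · exact (risingRatio_pos hz hs).le

lemma ofReal_risingRatio (z : ℝ) (s : ℕ) : ((risingRatio z s : ℝ) : ℂ) = risingRatio (z : ℂ) s := by
  cases s with
  | zero => simp [risingRatio]
  | succ s => simp [risingRatio]

/-- The Gauss product for Γ(1 + z) has n + 1 factors and equals (n + 1)! times the rising ratio at n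
+ 2. The last two factors of that ratio, and n / (n + 1), are divided out; all of them tend to 1. -/
lemma gammaSeq_eq (z : ℂ) (hz : 0 < (1 + z).re) {n : ℕ} (hn : n ≠ 0) :
    (Complex.GammaSeq (1 + z) n)⁻¹ * (n / (n + 1)) * (1 + z / ((n + 1 : ℕ) : ℂ))⁻¹ *
      (1 + z / (n : ℂ))⁻¹ = risingRatio z n * (n : ℂ) ^ (-z) := by
  have hne (k : ℕ) : (1 : ℂ) + z / ((k + 1 : ℕ) : ℂ) ≠ 0 := by
    intro h
    have hk : ((k + 1 : ℕ) : ℂ) ≠ 0 := by exact_mod_cast k.succ_ne_zero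
    have : z = -((k + 1 : ℕ) : ℂ) := by
      field_simp at h
      linear_combination h
    rw [this] at hz
    simp at hz
    have : (0 : ℝ) ≤ k := by positivity
    linarith
  have hn' : (n : ℂ) ≠ 0 := by exact_mod_cast hn
  have hn1 : ((n : ℂ) + 1) ≠ 0 := by exact_mod_cast n.succ_ne_zero
  have hnf : ((n.factorial : ℕ) : ℂ) ≠ 0 := by exact_mod_cast n.factorial_ne_zero
  have hprod : ∏ j ∈ Finset.range (n + 1), (1 + z + j) =
      ((n + 1).factorial : ℂ) * risingRatio z (n + 2) := by
    rw [risingRatio, ← Finset.prod_range_add_one_eq_factorial]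
    push_cast
    rw [← Finset.prod_mul_distrib]
    refine Finset.prod_congr rfl fun k _ ↦ ?_
    have : (k : ℂ) + 1 ≠ 0 := by exact_mod_cast k.succ_ne_zero
    field_simp
    ring
  have h1 : (1 : ℂ) + z / (n : ℂ) ≠ 0 := by
    obtain ⟨k, rfl⟩ := Nat.exists_eq_succ_of_ne_zero hn
    exact hne k
  rw [Complex.GammaSeq, hprod, risingRatio_succ _ n.succ_ne_zero, risingRatio_succ _ hn,
    Nat.succ_eq_add_one, Complex.cpow_add _ _ hn', Complex.cpow_one, Complex.cpow_neg,
    Nat.factorial_succ]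
  have h2 := hne n
  have hc : (n : ℂ) ^ z ≠ 0 := by simp [Complex.cpow_eq_zero_iff, hn']
  generalize (1 : ℂ) + z / ((n + 1 : ℕ) : ℂ) = a at *
  generalize (1 : ℂ) + z / (n : ℂ) = b at *
  push_cast
  field_simp

lemma tendsto_one_add_div (z : ℂ) : Tendsto (fun n : ℕ ↦ 1 + z / (n : ℂ)) atTop (𝓝 1) := by
  simpa using (tendsto_const_div_atTop_nhds_zero_nat z).const_add 1

/-- Asymptotics of the ratio of Gamma functions. -/
lemma tendsto_risingRatio {z : ℂ} (hz : 0 < (1 + z).re) :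
    Tendsto (fun n : ℕ ↦ risingRatio z n * (n : ℂ) ^ (-z)) atTop
      (𝓝 (Complex.Gamma (1 + z))⁻¹) := by
  have h := (((Complex.GammaSeq_tendsto_Gamma (1 + z)).inv₀
    (Complex.Gamma_ne_zero_of_re_pos hz)).mul (tendsto_natCast_div_add_atTop (1 : ℂ))).mul
    (((tendsto_one_add_div z).comp (tendsto_add_atTop_nat 1)).inv₀ one_ne_zero)
  have h := h.mul ((tendsto_one_add_div z).inv₀ one_ne_zero)
  simp only [inv_one, mul_one] at h
  refine h.congr' ?_
  filter_upwards [eventually_ne_atTop 0] with n hn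
  exact gammaSeq_eq z hz hn

lemma tendsto_risingRatio_real {z : ℝ} (hz : -1 < z) :
    Tendsto (fun n : ℕ ↦ risingRatio z n * (n : ℝ) ^ (-z)) atTop
      (𝓝 (Real.Gamma (1 + z))⁻¹) := by
  have h := tendsto_risingRatio (z := (z : ℂ)) (by simp; linarith)
  have h' := (Complex.continuous_re.tendsto _).comp h
  have e : ((Complex.Gamma (1 + z))⁻¹).re = (Real.Gamma (1 + z))⁻¹ := by
    rw [← Complex.ofReal_one, ← Complex.ofReal_add, Complex.Gamma_ofReal, ← Complex.ofReal_inv,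
      Complex.ofReal_re]
  rw [e] at h'
  refine h'.congr fun n ↦ ?_
  rw [Function.comp_apply, ← Complex.ofReal_neg, ← Complex.ofReal_natCast,
    ← Complex.ofReal_cpow n.cast_nonneg, ← ofReal_risingRatio, ← Complex.ofReal_mul,
    Complex.ofReal_re]

/-- A lower bound for the ratio with exponent `-1 / 2`. -/
lemma quarter_le_risingRatio_neg_half_sq_mul {s : ℕ} (hs : s ≠ 0) :
    1 / 4 ≤ risingRatio (-(1 / 2) : ℝ) s ^ 2 * s := by
  -- Induction fails for R(s)² s, which decreases. But R(s)² (s - 1) increases from the value 1/4 at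
  -- s = 2.
  have key (s : ℕ) : 1 / 4 ≤ risingRatio (-(1 / 2) : ℝ) (s + 2) ^ 2 * (s + 1) := by
    induction s with
    | zero => norm_num [risingRatio]
    | succ s ih =>
      rw [risingRatio_succ _ (by omega), mul_pow, mul_assoc]
      refine ih.trans ?_
      gcongr
      push_cast
      have : (0 : ℝ) < s + 2 := by positivity
      rw [← sub_nonneg]
      have : (1 + -(1 / 2) / ((s : ℝ) + 2)) ^ 2 * (s + 1 + 1) - (s + 1) = 1 / (4 * (s + 2)) := by
        field_simp
        ring
      rw [this]
      positivity
  obtain ⟨s, rfl⟩ := Nat.exists_eq_succ_of_ne_zero hs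
  cases s with
  | zero => norm_num [risingRatio]
  | succ s =>
    refine (key s).trans ?_
    gcongr
    push_cast
    linarith

end RisingRatio

end RecursiveTree

/-- Independence of two pairs whose first and second components are independent. -/
lemma ProbabilityTheory.IndepFun.prodMk_comm {Ω α β γ δ : Type*} [MeasurableSpace Ω]
    [MeasurableSpace α] [MeasurableSpace β] [MeasurableSpace γ] [MeasurableSpace δ]
    {P : Measure Ω} [IsProbabilityMeasure P] {a : Ω → α} {b : Ω → β} {c : Ω → γ} {d : Ω → δ}
    (hab : IndepFun a b P) (hcd : IndepFun c d P)
    (h : IndepFun (fun ω ↦ (a ω, b ω)) (fun ω ↦ (c ω, d ω)) P)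
    (ha : Measurable a) (hb : Measurable b) (hc : Measurable c) (hd : Measurable d) :
    IndepFun (fun ω ↦ (a ω, c ω)) (fun ω ↦ (b ω, d ω)) P := by
  rw [indepFun_iff_measure_inter_preimage_eq_mul] at hab hcd h
  rw [IndepFun_iff_Indep]
  refine IndepSets.indep (ha.prodMk hc).comap_le (hb.prodMk hd).comap_le
    (isPiSystem_prod.comap _) (isPiSystem_prod.comap _)
    (by rw [← generateFrom_prod, MeasurableSpace.comap_generateFrom]; rfl)
    (by rw [← generateFrom_prod, MeasurableSpace.comap_generateFrom]; rfl) ?_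
  rw [IndepSets_iff]
  rintro _ _ ⟨_, ⟨s, hs, t, ht, rfl⟩, rfl⟩ ⟨_, ⟨s', hs', t', ht', rfl⟩, rfl⟩
  simp only [Set.mem_ofPred_eq] at hs ht hs' ht'
  have e1 : (fun ω ↦ (a ω, c ω)) ⁻¹' (s ×ˢ t) ∩ (fun ω ↦ (b ω, d ω)) ⁻¹' (s' ×ˢ t') =
      (fun ω ↦ (a ω, b ω)) ⁻¹' (s ×ˢ s') ∩ (fun ω ↦ (c ω, d ω)) ⁻¹' (t ×ˢ t') := by
    ext ω; simp only [Set.mem_inter_iff, Set.mem_preimage, Set.mem_prod]; tauto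
  have h1 := h (s ×ˢ s') (t ×ˢ t') (hs.prod hs') (ht.prod ht')
  have h2 := h (s ×ˢ Set.univ) (t ×ˢ Set.univ) (hs.prod .univ) (ht.prod .univ)
  have h3 := h (Set.univ ×ˢ s') (Set.univ ×ˢ t') (.prod .univ hs') (.prod .univ ht')
  simp only [Set.mk_preimage_prod, Set.preimage_univ, Set.inter_univ, Set.univ_inter] at h1 h2 h3 e1 ⊢
  rw [e1, h1, h2, h3, hab _ _ hs hs', hcd _ _ ht ht']
  ring

/-! ### Independence of the next vertex from the past -/

namespace RecursiveTree

variable {Ω : Type*} [mΩ : MeasurableSpace Ω] {P : Measure Ω} {u : ℕ → Ω → ℕ} {ε : ℕ → Ω → ℝ}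

namespace IsDestruction

/-- The information carried by the first `n + 1` vertices. -/
def past (h : IsDestruction P u ε) : Filtration ℕ mΩ where
  seq n := ⨆ k ∈ Set.Iio n,
    (MeasurableSpace.comap (u k) inferInstance ⊔ MeasurableSpace.comap (ε k) inferInstance)
  mono' _ _ hij := biSup_mono fun _ hk ↦ lt_of_lt_of_le hk hij
  le' _ := iSup₂_le fun k _ ↦ sup_le (h.measurable_parent k).comap_le (h.measurable_clock k).comap_le

variable (h : IsDestruction P u ε)
include h

lemma measurable_parent_past {k n : ℕ} (hk : k < n) : Measurable[h.past n] (u k) :=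
  measurable_iff_comap_le.2 (le_sup_left.trans
    (le_biSup (fun k ↦ MeasurableSpace.comap (u k) inferInstance ⊔
      MeasurableSpace.comap (ε k) inferInstance) (Set.mem_Iio.2 hk)))

lemma measurable_clock_past {k n : ℕ} (hk : k < n) : Measurable[h.past n] (ε k) :=
  measurable_iff_comap_le.2 (le_sup_right.trans
    (le_biSup (fun k ↦ MeasurableSpace.comap (u k) inferInstance ⊔
      MeasurableSpace.comap (ε k) inferInstance) (Set.mem_Iio.2 hk)))

lemma ae_parent_le : ∀ᵐ ω ∂P, ∀ k, u k ω ≤ k := by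
  rw [ae_all_iff]
  intro k
  have : ∀ᵐ x ∂(uniformOn (Set.Iic k) : Measure ℕ), x ≤ k := by
    rw [ae_iff, uniformOn_eq_zero_iff (Set.finite_Iic k)]
    ext x
    simp
  rw [← (h.law_parent k).map_eq] at this
  exact ae_of_ae_map (h.measurable_parent k).aemeasurable this

lemma measure_parent_eq {k v : ℕ} (hv : v ≤ k) : P.real {ω | u k ω = v} = 1 / (k + 1) := by
  have : P {ω | u k ω = v} = uniformOn (Set.Iic k) {v} :=
    (h.law_parent k).measure_eq (p := (· = v)) (measurableSet_singleton v)
  rw [Measure.real, this, uniformOn, cond_apply (Set.finite_Iic k).measurableSet,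
    Set.inter_singleton_of_mem (by simpa using hv)]
  rw [← Finset.coe_Iic, Measure.count_apply_finset]
  simp only [Nat.card_Iic, Measure.count_singleton, mul_one, ENNReal.toReal_inv, ENNReal.toReal_natCast]
  push_cast
  rw [one_div]

lemma measure_lt_clock (k : ℕ) (t : ℝ≥0) : P.real {ω | (t : ℝ) < ε k ω} = Real.exp (-t) := by
  have := isProbabilityMeasure_expMeasure one_pos
  have e : P {ω | (t : ℝ) < ε k ω} = expMeasure 1 (Set.Ioi (t : ℝ)) :=
    (h.law_clock k).measure_eq (p := fun x ↦ (t : ℝ) < x) measurableSet_Ioi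
  rw [Measure.real, e, ← Measure.real, ← Set.compl_Iic, probReal_compl_eq_one_sub measurableSet_Iic,
    ← cdf_eq_real, cdf_expMeasure_eq one_pos, if_pos t.coe_nonneg]
  simp

variable [IsProbabilityMeasure P]

/-- Parents are independent, clocks are independent, and the two families are independent of each
other; `prodMk_comm` regroups these as earlier pairs against the n-th pair. -/
lemma indep_past (n : ℕ) :
    Indep (h.past n) (MeasurableSpace.comap (fun ω ↦ (u n ω, ε n ω)) inferInstance) P := by
  have hm (n : ℕ) : Measurable (u n) := h.measurable_parent n
  have hm' (n : ℕ) : Measurable (ε n) := h.measurable_clock n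
  have hd : Disjoint (Finset.range n) {n} := by simp
  have ha : IndepFun (fun ω (k : Finset.range n) ↦ u k ω) (u n) P :=
    (h.indep_parent.indepFun_finset _ _ hd hm).comp (φ := id)
      (ψ := fun x : ({n} : Finset ℕ) → ℕ ↦ x ⟨n, Finset.mem_singleton_self n⟩)
      measurable_id (measurable_pi_apply _)
  have hb : IndepFun (fun ω (k : Finset.range n) ↦ ε k ω) (ε n) P :=
    (h.indep_clock.indepFun_finset _ _ hd hm').comp (φ := id)
      (ψ := fun x : ({n} : Finset ℕ) → ℝ ↦ x ⟨n, Finset.mem_singleton_self n⟩)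
      measurable_id (measurable_pi_apply _)
  have hc := h.indep_parent_clock.comp
    (φ := fun x ↦ ((fun k : Finset.range n ↦ x k), x n))
    (ψ := fun x ↦ ((fun k : Finset.range n ↦ x k), x n)) (by fun_prop) (by fun_prop)
  have hI := ha.prodMk_comm hb hc (by fun_prop) (hm n) (by fun_prop) (hm' n)
  rw [IndepFun_iff_Indep] at hI
  refine indep_of_indep_of_le_left hI (iSup₂_le fun k hk ↦ sup_le ?_ ?_)
  · have : u k = (fun x : (Finset.range n → ℕ) × (Finset.range n → ℝ) ↦
        x.1 ⟨k, Finset.mem_range.2 hk⟩) ∘ fun ω ↦ ((fun k ↦ u k ω), (fun k ↦ ε k ω)) := rfl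
    rw [this, ← MeasurableSpace.comap_comp]
    exact MeasurableSpace.comap_mono (Measurable.comap_le (by fun_prop))
  · have : ε k = (fun x : (Finset.range n → ℕ) × (Finset.range n → ℝ) ↦
        x.2 ⟨k, Finset.mem_range.2 hk⟩) ∘ fun ω ↦ ((fun k ↦ u k ω), (fun k ↦ ε k ω)) := rfl
    rw [this, ← MeasurableSpace.comap_comp]
    exact MeasurableSpace.comap_mono (Measurable.comap_le (by fun_prop))

omit [IsProbabilityMeasure P] in
lemma measure_parent_eq_lt_clock {k v : ℕ} (hv : v ≤ k) (t : ℝ≥0) :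
    P.real {ω | u k ω = v ∧ (t : ℝ) < ε k ω} = Real.exp (-t) / (k + 1) := by
  have hc : IndepFun (u k) (ε k) P :=
    h.indep_parent_clock.comp (measurable_pi_apply k) (measurable_pi_apply k)
  have := (indepFun_iff_measure_inter_preimage_eq_mul.1 hc) {v} (Set.Ioi (t : ℝ))
    (measurableSet_singleton v) measurableSet_Ioi
  have e := h.measure_parent_eq hv
  have e' := h.measure_lt_clock k t
  rw [Measure.real] at e e' ⊢
  change (P ({ω | u k ω = v} ∩ {ω | (t : ℝ) < ε k ω})) = P {ω | u k ω = v} *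
    P {ω | (t : ℝ) < ε k ω} at this
  rw [Set.ofPred_and, this, ENNReal.toReal_mul, e, e']
  ring

/-- The attachment event is independent of the past and has probability e^{-t} / (n + 1).
Integrating over past events replaces conditional expectations. -/
lemma setIntegral_indicator_parent_eq {𝕜 : Type*} [RCLike 𝕜] {n v : ℕ} (hv : v ≤ n) (t : ℝ≥0)
    {H : Ω → 𝕜} (hH : Measurable[h.past n] H) {A : Set Ω} (hA : MeasurableSet[h.past n] A) :
    ∫ ω in A, {ω | u n ω = v ∧ (t : ℝ) < ε n ω}.indicator H ω ∂P =
      ((Real.exp (-t) / (n + 1) : ℝ) : 𝕜) * ∫ ω in A, H ω ∂P := by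
  have hle := h.past.le n
  have hB' : MeasurableSet[MeasurableSpace.comap (fun ω ↦ (u n ω, ε n ω)) inferInstance]
      {ω | u n ω = v ∧ (t : ℝ) < ε n ω} :=
    ⟨{v} ×ˢ Set.Ioi (t : ℝ), (measurableSet_singleton v).prod measurableSet_Ioi, rfl⟩
  have hm := ((h.measurable_parent n).prodMk (h.measurable_clock n)).comap_le
  have hAH : Measurable[h.past n] (A.indicator H) := hH.indicator hA
  have := Indep.setIntegral_eq_smul (P := P) (X := A.indicator H) (f := id) hm
    (indep_of_indep_of_le_right (h.indep_past n).symm hAH.comap_le)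
    (hAH.mono hle le_rfl).aemeasurable hB' aestronglyMeasurable_id
  rw [h.measure_parent_eq_lt_clock hv] at this
  simp only [id] at this
  rw [← integral_indicator (hle _ hA), ← integral_indicator (hle _ hA), ← RCLike.real_smul_eq_coe_mul,
    ← this, ← integral_indicator (hm _ hB'), Set.indicator_indicator, Set.indicator_indicator,
    Set.inter_comm]

end IsDestruction

end RecursiveTree

namespace RecursiveTree

/-! ### The martingale of products of rising ratios -/

section Recursion

variable {𝕜 : Type*} [RCLike 𝕜]

/-- The product of the rising ratios of the sizes of the blocks with top vertices in `I`, among the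
first `n` vertices. -/
noncomputable def sizeProd (I : Finset ℕ) (z : ℕ → 𝕜) (u : ℕ → ℕ) (ε : ℕ → ℝ) (t : ℝ≥0) (n : ℕ) :
    𝕜 :=
  ∏ i ∈ I, risingRatio (z i) (size u ε t i n)

lemma sizeProd_eq_zero {I : Finset ℕ} (z : ℕ → 𝕜) {u : ℕ → ℕ} {ε : ℕ → ℝ} {t : ℝ≥0} {n i : ℕ}
    (hi : i ∈ I) (h : size u ε t i n = 0) : sizeProd I z u ε t n = 0 :=
  Finset.prod_eq_zero hi (by rw [h, risingRatio_zero_right])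

lemma norm_sizeProd_le (I : Finset ℕ) (z : ℕ → 𝕜) (u : ℕ → ℕ) (ε : ℕ → ℝ) (t : ℝ≥0) (n : ℕ) :
    ‖sizeProd I z u ε t n‖ ≤ ∏ i ∈ I, (1 + ‖z i‖) ^ n := by
  rw [sizeProd, norm_prod]
  exact Finset.prod_le_prod (fun _ _ ↦ norm_nonneg _) fun i _ ↦ norm_risingRatio_le _ (size_le i n)

/-- The growth of `sizeProd` when the vertex `n + 1` is attached below the vertex `v`. -/
noncomputable def sizeProdIncr (I : Finset ℕ) (z : ℕ → 𝕜) (u : ℕ → ℕ) (ε : ℕ → ℝ) (t : ℝ≥0)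
    (n v : ℕ) : 𝕜 :=
  ∑ i ∈ I, if root u ε t v = i then sizeProd I z u ε t n * (z i / (size u ε t i n : 𝕜)) else 0

lemma norm_sizeProdIncr_le (I : Finset ℕ) (z : ℕ → 𝕜) (u : ℕ → ℕ) (ε : ℕ → ℝ) (t : ℝ≥0)
    (n v : ℕ) :
    ‖sizeProdIncr I z u ε t n v‖ ≤ ∑ i ∈ I, (∏ i ∈ I, (1 + ‖z i‖) ^ n) * ‖z i‖ := by
  have h0 : 0 ≤ ∏ i ∈ I, (1 + ‖z i‖) ^ n := Finset.prod_nonneg fun _ _ ↦ by positivity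
  refine (norm_sum_le _ _).trans (Finset.sum_le_sum fun i _ ↦ ?_)
  split_ifs
  · rw [norm_mul, norm_div, RCLike.norm_natCast]
    refine mul_le_mul (norm_sizeProd_le _ _ _ _ _ _) ?_ (by positivity) h0
    rcases Nat.eq_zero_or_pos (size u ε t i n) with h | h
    · simp [h]
    · exact div_le_self (norm_nonneg _) (by exact_mod_cast h)
  · rw [norm_zero]
    positivity

/-- At most one block of `I` grows, and `hI` prevents the new vertex n + 1 from being itself a top
in `I`. Summing over all possible parents separates quantities determined by the past from the
independent attachment event. -/
lemma sizeProd_add_two {I : Finset ℕ} (z : ℕ → 𝕜) {u : ℕ → ℕ} {ε : ℕ → ℝ} {t : ℝ≥0} {n : ℕ}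
    (hu : u n ≤ n) (hI : ∀ i ∈ I, i ≤ n) :
    sizeProd I z u ε t (n + 2) = sizeProd I z u ε t (n + 1) +
      ∑ v ∈ Finset.range (n + 1),
        open Classical in
        if u n = v ∧ (t : ℝ) < ε n then sizeProdIncr I z u ε t (n + 1) v else 0 := by
  rcases le_or_gt (ε n) t with ht | ht
  · rw [Finset.sum_eq_zero fun v _ ↦ if_neg fun h ↦ ht.not_gt h.2, add_zero]
    exact Finset.prod_congr rfl fun i hi ↦ by rw [size_add_two_of_le ht (hI i hi)]
  · rw [Finset.sum_eq_single (u n) (fun v _ hv ↦ if_neg fun h ↦ hv h.1.symm)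
      (fun h ↦ absurd (Finset.mem_range.2 (by omega)) h), if_pos ⟨rfl, ht⟩, sizeProdIncr]
    set r := root u ε t (u n) with hr
    simp only [eq_comm (a := r)]
    rw [Finset.sum_ite_eq' I r]
    have hstep (i : ℕ) : size u ε t i (n + 2) = size u ε t i (n + 1) + if r = i then 1 else 0 :=
      size_add_two_of_lt ht hu
    split_ifs with hrI
    · have hs : size u ε t r (n + 1) ≠ 0 := (size_pos_of_root_eq hr.symm (by omega)).ne'
      rw [sizeProd, sizeProd, ← Finset.mul_prod_erase _ _ hrI, ← Finset.mul_prod_erase _ _ hrI,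
        hstep r, if_pos rfl, risingRatio_succ _ hs]
      have : ∏ i ∈ I.erase r, risingRatio (z i) (size u ε t i (n + 2)) =
          ∏ i ∈ I.erase r, risingRatio (z i) (size u ε t i (n + 1)) :=
        Finset.prod_congr rfl fun i hi ↦ by
          rw [hstep, if_neg (Finset.ne_of_mem_erase hi).symm, add_zero]
      rw [this]
      ring
    · rw [add_zero]
      refine Finset.prod_congr rfl fun i hi ↦ ?_
      rw [hstep, if_neg (fun h : r = i ↦ hrI (h ▸ hi)), add_zero]

/-- Each of the S vertices of block i contributes z_i / S times the product, so S cancels; if the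
block is absent, both sides are zero. -/
lemma sum_sizeProdIncr (I : Finset ℕ) (z : ℕ → 𝕜) (u : ℕ → ℕ) (ε : ℕ → ℝ) (t : ℝ≥0) (n : ℕ) :
    ∑ v ∈ Finset.range n, sizeProdIncr I z u ε t n v = (∑ i ∈ I, z i) * sizeProd I z u ε t n := by
  simp only [sizeProdIncr]
  rw [Finset.sum_comm, Finset.sum_mul]
  refine Finset.sum_congr rfl fun i hi ↦ ?_
  have : ∑ v ∈ Finset.range n, (if root u ε t v = i then
      sizeProd I z u ε t n * (z i / (size u ε t i n : 𝕜)) else 0) =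
      (size u ε t i n : 𝕜) * (sizeProd I z u ε t n * (z i / (size u ε t i n : 𝕜))) := by
    rw [← Finset.sum_filter, Finset.sum_const, nsmul_eq_mul, size, Nat.count_eq_card_filter_range]
  rw [this]
  by_cases h : size u ε t i n = 0
  · simp [sizeProd_eq_zero z hi h]
  · have : (size u ε t i n : 𝕜) ≠ 0 := by exact_mod_cast h
    field_simp

end Recursion

section Measurability

variable {Ω : Type*} [MeasurableSpace Ω] {u : ℕ → Ω → ℕ} {ε : ℕ → Ω → ℝ} {n : ℕ}

lemma measurable_root (hu : ∀ k < n, Measurable (u k)) (hε : ∀ k < n, Measurable (ε k))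
    (t : ℝ≥0) {j : ℕ} (hj : j ≤ n) : Measurable fun ω ↦ root (u · ω) (ε · ω) t j := by
  induction j using Nat.strong_induction_on with
  | _ j ih =>
    cases j with
    | zero => simp only [root_zero]; exact measurable_const
    | succ k =>
      -- The parent is random, so measurability is needed jointly in the index and ω; the index is
      -- countable, and the cut-off at k keeps it within the induction hypothesis.
      have hG : Measurable fun q : ℕ × Ω ↦
          if q.1 ≤ k then root (u · q.2) (ε · q.2) t q.1 else 0 := by
        refine measurable_from_prod_countable_right fun v ↦ ?_
        by_cases hv : v ≤ k
        · simpa [hv] using ih v (by omega) (by omega)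
        · simp [hv]
      have e : (fun ω ↦ root (u · ω) (ε · ω) t (k + 1)) = fun ω ↦
          open Classical in if (t : ℝ) < ε k ω ∧ u k ω ≤ k then
            (if u k ω ≤ k then root (u · ω) (ε · ω) t (u k ω) else 0) else k + 1 := by
        funext ω
        rw [root]
        by_cases h : (t : ℝ) < ε k ω ∧ u k ω ≤ k
        · rw [dif_pos h, if_pos h, if_pos h.2]
        · rw [dif_neg h, if_neg h]
      rw [e]
      refine Measurable.ite ?_ (hG.comp ((hu k (by omega)).prodMk measurable_id)) measurable_const
      exact (measurableSet_lt measurable_const (hε k (by omega))).inter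
        (measurableSet_le (hu k (by omega)) measurable_const)

lemma measurable_size (hu : ∀ k < n, Measurable (u k)) (hε : ∀ k < n, Measurable (ε k))
    (t : ℝ≥0) (m : ℕ) : Measurable fun ω ↦ size (u · ω) (ε · ω) t m (n + 1) := by
  simp only [size_succ_eq_sum]
  refine Finset.measurable_sum _ fun v hv ↦ Measurable.ite ?_ measurable_const measurable_const
  exact measurable_root hu hε t (Nat.lt_succ_iff.1 (Finset.mem_range.1 hv))
    (measurableSet_singleton m)

variable {𝕜 : Type*} [RCLike 𝕜]

lemma measurable_sizeProd (hu : ∀ k < n, Measurable (u k)) (hε : ∀ k < n, Measurable (ε k))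
    (t : ℝ≥0) (I : Finset ℕ) (z : ℕ → 𝕜) :
    Measurable fun ω ↦ sizeProd I z (u · ω) (ε · ω) t (n + 1) :=
  Finset.measurable_prod _ fun i _ ↦ (measurable_from_nat (f := risingRatio (z i))).comp
    (measurable_size hu hε t i)

lemma measurable_sizeProdIncr (hu : ∀ k < n, Measurable (u k)) (hε : ∀ k < n, Measurable (ε k))
    (t : ℝ≥0) (I : Finset ℕ) (z : ℕ → 𝕜) {v : ℕ} (hv : v ≤ n) :
    Measurable fun ω ↦ sizeProdIncr I z (u · ω) (ε · ω) t (n + 1) v := by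
  refine Finset.measurable_sum _ fun i _ ↦ Measurable.ite
    (measurable_root hu hε t hv (measurableSet_singleton i)) ?_ measurable_const
  exact (measurable_sizeProd hu hε t I z).mul
    ((measurable_from_nat (f := fun s : ℕ ↦ z i / (s : 𝕜))).comp (measurable_size hu hε t i))

end Measurability

namespace IsDestruction

variable {Ω : Type*} [mΩ : MeasurableSpace Ω] {P : Measure Ω} [IsProbabilityMeasure P]
  {u : ℕ → Ω → ℕ} {ε : ℕ → Ω → ℝ} {𝕜 : Type*} [RCLike 𝕜]
  (h : IsDestruction P u ε) (t : ℝ≥0) (I : Finset ℕ) (z : ℕ → 𝕜)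
include h

omit [IsProbabilityMeasure P] in
lemma measurable_sizeProd_past (n : ℕ) :
    Measurable[h.past n] fun ω ↦ sizeProd I z (u · ω) (ε · ω) t (n + 1) :=
  @measurable_sizeProd Ω (h.past n) u ε n 𝕜 _ (fun _ ↦ h.measurable_parent_past)
    (fun _ ↦ h.measurable_clock_past) t I z

lemma integrable_sizeProd (n : ℕ) :
    Integrable (fun ω ↦ sizeProd I z (u · ω) (ε · ω) t (n + 1)) P :=
  Integrable.of_bound (((h.measurable_sizeProd_past t I z n).mono
    (h.past.le n) le_rfl).aestronglyMeasurable) _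
    (ae_of_all _ fun ω ↦ norm_sizeProd_le I z (u · ω) (ε · ω) t (n + 1))

/-- The conditional growth of `sizeProd`, in integrated form. -/
lemma setIntegral_sizeProd_succ {n : ℕ} (hI : ∀ i ∈ I, i ≤ n) {A : Set Ω}
    (hA : MeasurableSet[h.past n] A) :
    ∫ ω in A, sizeProd I z (u · ω) (ε · ω) t (n + 2) ∂P =
      (1 + ((Real.exp (-t) : ℝ) : 𝕜) * (∑ i ∈ I, z i) / ((n + 1 : ℕ) : 𝕜)) *
        ∫ ω in A, sizeProd I z (u · ω) (ε · ω) t (n + 1) ∂P := by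
  have hmeas {v : ℕ} (hv : v ≤ n) : Measurable[h.past n]
      fun ω ↦ sizeProdIncr I z (u · ω) (ε · ω) t (n + 1) v :=
    @measurable_sizeProdIncr Ω (h.past n) u ε n 𝕜 _ (fun _ ↦ h.measurable_parent_past)
      (fun _ ↦ h.measurable_clock_past) t I z v hv
  have hint {v : ℕ} (hv : v ≤ n) :
      Integrable (fun ω ↦ sizeProdIncr I z (u · ω) (ε · ω) t (n + 1) v) P :=
    Integrable.of_bound (((hmeas hv).mono (h.past.le n) le_rfl).aestronglyMeasurable) _
      (ae_of_all _ fun ω ↦ norm_sizeProdIncr_le I z (u · ω) (ε · ω) t (n + 1) v)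
  have hB (v : ℕ) : MeasurableSet {ω | u n ω = v ∧ (t : ℝ) < ε n ω} :=
    (h.measurable_parent n (measurableSet_singleton v)).inter
      (measurableSet_lt measurable_const (h.measurable_clock n))
  have e1 : ∫ ω in A, sizeProd I z (u · ω) (ε · ω) t (n + 2) ∂P =
      ∫ ω in A, (sizeProd I z (u · ω) (ε · ω) t (n + 1) + ∑ v ∈ Finset.range (n + 1),
        {ω | u n ω = v ∧ (t : ℝ) < ε n ω}.indicator
          (fun ω ↦ sizeProdIncr I z (u · ω) (ε · ω) t (n + 1) v) ω) ∂P := by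
    refine integral_congr_ae (ae_restrict_of_ae ?_)
    filter_upwards [h.ae_parent_le] with ω hω
    rw [sizeProd_add_two z (hω n) hI]
    simp only [Set.indicator_apply, Set.mem_ofPred_eq]
  have hle {v : ℕ} (hv : v ∈ Finset.range (n + 1)) : v ≤ n :=
    Nat.lt_succ_iff.1 (Finset.mem_range.1 hv)
  rw [e1, integral_add (h.integrable_sizeProd t I z n).integrableOn
    (integrable_finsetSum _ fun v hv ↦ ((hint (hle hv)).indicator (hB v)).integrableOn),
    integral_finsetSum _ fun v hv ↦ ((hint (hle hv)).indicator (hB v)).integrableOn,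
    Finset.sum_congr rfl fun v hv ↦
      h.setIntegral_indicator_parent_eq (hle hv) t (hmeas (hle hv)) hA,
    ← Finset.mul_sum, ← integral_finsetSum _ fun v hv ↦ (hint (hle hv)).integrableOn]
  simp only [sum_sizeProdIncr]
  rw [integral_const_mul]
  push_cast
  ring

/-- Iterating the one-step growth telescopes. The cross-multiplied form avoids dividing by a rising
ratio that may vanish for general exponents. -/
lemma integral_sizeProd {N n : ℕ} (hI : ∀ i ∈ I, i ≤ N) (hn : N ≤ n) :
    (∫ ω, sizeProd I z (u · ω) (ε · ω) t (n + 1) ∂P) *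
        risingRatio (((Real.exp (-t) : ℝ) : 𝕜) * ∑ i ∈ I, z i) (N + 1) =
      (∫ ω, sizeProd I z (u · ω) (ε · ω) t (N + 1) ∂P) *
        risingRatio (((Real.exp (-t) : ℝ) : 𝕜) * ∑ i ∈ I, z i) (n + 1) := by
  induction n, hn using Nat.le_induction with
  | base => rfl
  | succ n hn ih =>
    have := h.setIntegral_sizeProd_succ t I z (fun i hi ↦ (hI i hi).trans hn) MeasurableSet.univ
    rw [setIntegral_univ, setIntegral_univ] at this
    rw [this, mul_assoc, ih, risingRatio_succ _ n.succ_ne_zero]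
    ring

/-- The renormalised rising ratio of the size of a block converges. -/
lemma ae_exists_tendsto_risingRatio {z : ℝ} (hz : -1 < z) (m : ℕ) :
    ∀ᵐ ω ∂P, ∃ c, Tendsto (fun n ↦ risingRatio z (size (u · ω) (ε · ω) t m n) /
      risingRatio (Real.exp (-t) * z) n) atTop (𝓝 c) := by
  have hp : Real.exp (-t) ≤ 1 := by simp
  have hp0 := Real.exp_pos (-(t : ℝ))
  have hpz : -1 < Real.exp (-t) * z := by nlinarith
  have hpos (n : ℕ) := risingRatio_pos hpz n.succ_ne_zero
  -- Time is shifted by m so that vertex m is already present and its block can no longer be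
  -- created.
  let M (n : ℕ) (ω : Ω) : ℝ := sizeProd {m} (fun _ ↦ z) (u · ω) (ε · ω) t (n + m + 1) /
    risingRatio (Real.exp (-t) * z) (n + m + 1)
  have hM0 (n : ℕ) (ω : Ω) : 0 ≤ M n ω :=
    div_nonneg (Finset.prod_nonneg fun _ _ ↦ risingRatio_nonneg hz _) (hpos _).le
  let ℱ : Filtration ℕ mΩ :=
    { seq := fun n ↦ h.past (n + m)
      mono' := fun i j hij ↦ h.past.mono (by omega)
      le' := fun n ↦ h.past.le _ }
  have hint (n : ℕ) : Integrable (M n) P := (h.integrable_sizeProd t {m} _ (n + m)).div_const _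
  have hmart : Martingale M ℱ P := by
    refine martingale_of_setIntegral_eq_succ (fun n ↦ ?_) hint fun n A hA ↦ ?_
    · exact ((h.measurable_sizeProd_past t {m} (fun _ ↦ z) (n + m)).div_const _).stronglyMeasurable
    · have := h.setIntegral_sizeProd_succ t {m} (fun _ ↦ z) (n := n + m) (by simp) hA
      simp only [M]
      rw [integral_div, integral_div, show n + 1 + m + 1 = n + m + 2 by ring, this,
        risingRatio_succ _ (n + m).succ_ne_zero, Finset.sum_singleton]
      have h2 := hpos (n + m + 1)
      rw [risingRatio_succ _ (n + m).succ_ne_zero] at h2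
      have h3 := right_ne_zero_of_mul h2.ne'
      rw [RCLike.ofReal_real_eq_id, id, mul_comm (risingRatio _ _),
        Nat.succ_eq_add_one, mul_div_mul_left _ _ h3]
  -- A nonnegative martingale has constant L¹ norm, so Doob's convergence theorem applies.
  have hbdd (n : ℕ) : eLpNorm (M n) 1 P ≤ ((∫ ω, M 0 ω ∂P).toNNReal) := by
    have e : ∫ ω, M n ω ∂P = ∫ ω, M 0 ω ∂P := by
      have := hmart.setIntegral_eq (Nat.zero_le n) MeasurableSet.univ
      rw [setIntegral_univ, setIntegral_univ] at this
      exact this.symm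
    rw [eLpNorm_one_eq_lintegral_enorm, ← e, ← ENNReal.ofReal,
      ofReal_integral_eq_lintegral_ofReal (hint n) (ae_of_all _ (hM0 n))]
    refine lintegral_mono fun ω ↦ ?_
    rw [Real.enorm_of_nonneg (hM0 n ω)]
  filter_upwards [hmart.submartingale.ae_tendsto_limitProcess hbdd] with ω hω
  refine ⟨_, (tendsto_add_atTop_iff_nat (m + 1)).1 (hω.congr fun n ↦ ?_)⟩
  simp only [M, sizeProd, Finset.prod_singleton, add_assoc]

end IsDestruction

end RecursiveTree

/-! ### Existence, positivity and measurability of the weights -/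

namespace RecursiveTree

namespace IsDestruction

variable {Ω : Type*} [mΩ : MeasurableSpace Ω] {P : Measure Ω} [IsProbabilityMeasure P]
  {u : ℕ → Ω → ℕ} {ε : ℕ → Ω → ℝ} (h : IsDestruction P u ε) (t : ℝ≥0)
include h

lemma ae_exists_tendsto_risingRatio_mul_rpow {z : ℝ} (hz : -1 < z) (m : ℕ) :
    ∀ᵐ ω ∂P, ∃ c, Tendsto (fun n : ℕ ↦ risingRatio z (size (u · ω) (ε · ω) t m n) *
      (n : ℝ) ^ (-(Real.exp (-t) * z))) atTop (𝓝 c) := by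
  have hp : Real.exp (-t) ≤ 1 := by simp
  have hp0 := Real.exp_pos (-(t : ℝ))
  have hpz : -1 < Real.exp (-t) * z := by nlinarith
  filter_upwards [h.ae_exists_tendsto_risingRatio t hz m] with ω ⟨c, hc⟩
  refine ⟨_, (hc.mul (tendsto_risingRatio_real hpz)).congr' ?_⟩
  filter_upwards [eventually_ne_atTop 0] with n hn
  have := (risingRatio_pos hpz hn).ne'
  field_simp

/-- The renormalised size of the block with top vertex `m` converges, and its limit is positive if
there is such a block. -/
lemma ae_exists_tendsto_size (m : ℕ) :
    ∀ᵐ ω ∂P, ∃ c, Tendsto (fun n : ℕ ↦ (n : ℝ) ^ (-Real.exp (-t)) *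
      size (u · ω) (ε · ω) t m n) atTop (𝓝 c) ∧ (root (u · ω) (ε · ω) t m = m → 0 < c) := by
  filter_upwards [h.ae_exists_tendsto_risingRatio_mul_rpow t (z := 1) (by norm_num) m,
    h.ae_exists_tendsto_risingRatio_mul_rpow t (z := -(1 / 2)) (by norm_num) m]
    with ω ⟨c, hc⟩ ⟨b, hb⟩
  simp only [risingRatio_one_left, mul_one] at hc
  refine ⟨c, hc.congr fun n ↦ mul_comm _ _, fun hm ↦ ?_⟩
  have hc0 : 0 ≤ c := ge_of_tendsto' hc fun n ↦ by positivity
  -- The powers of n cancel, leaving R(-1/2, S)² S ≥ 1/4. Hence b² c ≥ 1/4 with b finite, which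
  -- excludes c = 0.
  have hlim := (hb.pow 2).mul hc
  have hge : 1 / 4 ≤ b ^ 2 * c := by
    refine ge_of_tendsto hlim ?_
    filter_upwards [eventually_gt_atTop m] with n hn
    refine (quarter_le_risingRatio_neg_half_sq_mul (size_pos_of_root_eq hm hn).ne').trans_eq ?_
    have hn0 : (0 : ℝ) < n := by exact_mod_cast (Nat.zero_le m).trans_lt hn
    have e : ((n : ℝ) ^ (-(Real.exp (-t) * -(1 / 2)))) ^ 2 * (n : ℝ) ^ (-Real.exp (-t)) = 1 := by
      rw [← Real.rpow_natCast, ← Real.rpow_mul hn0.le, ← Real.rpow_add hn0]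
      refine (congrArg _ ?_).trans (Real.rpow_zero _)
      push_cast
      ring
    linear_combination (-(risingRatio (-(1 / 2) : ℝ) (size (u · ω) (ε · ω) t m n) ^ 2 *
      size (u · ω) (ε · ω) t m n)) * e
  rcases hc0.eq_or_lt with h0 | h0
  · rw [← h0] at hge
    norm_num at hge
  · exact h0

/-- The weights exist. -/
lemma ae_tendsto_scaledCount (i : ℕ) :
    ∀ᵐ ω ∂P, Tendsto (scaledCount (block (partition (u · ω) (ε · ω) t) i) t) atTop
      (𝓝 (weight (u · ω) (ε · ω) t i)) := by
  filter_upwards [h.ae_parent_le, ae_all_iff.2 (h.ae_exists_tendsto_size t)] with ω hu hω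
  suffices ∃ c, Tendsto (scaledCount (block (partition (u · ω) (ε · ω) t) i) t) atTop (𝓝 c) from
    tendsto_nhds_limUnder this
  by_cases hi : ∃ m, root (u · ω) (ε · ω) t m = m ∧
      Nat.count (fun j ↦ root (u · ω) (ε · ω) t j = j) m = i
  · obtain ⟨m, hm, rfl⟩ := hi
    obtain ⟨c, hc, -⟩ := hω m
    exact ⟨c, hc.congr fun n ↦ (scaledCount_block hu hm n).symm⟩
  · rw [block_eq_empty hu fun m hm hmi ↦ hi ⟨m, hm, hmi⟩]
    exact ⟨0, tendsto_const_nhds.congr fun n ↦ (scaledCount_empty n).symm⟩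

/-- While the first `N` vertices are separate, their blocks are the first `N` ones. -/
lemma ae_tendsto_size (N : ℕ) :
    ∀ᵐ ω ∂P, (∀ j < N, root (u · ω) (ε · ω) t j = j) → ∀ i < N,
      0 < weight (u · ω) (ε · ω) t i ∧
      Tendsto (fun n : ℕ ↦ (n : ℝ) ^ (-Real.exp (-t)) * size (u · ω) (ε · ω) t i n) atTop
        (𝓝 (weight (u · ω) (ε · ω) t i)) := by
  filter_upwards [h.ae_parent_le, ae_all_iff.2 (h.ae_exists_tendsto_size t),
    ae_all_iff.2 (h.ae_tendsto_scaledCount t)] with ω hu hω hw hN i hi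
  obtain ⟨c, hc, hc0⟩ := hω i
  have e : Nat.count (fun j ↦ root (u · ω) (ε · ω) t j = j) i = i :=
    Nat.count_iff_forall.2 fun j hj ↦ hN j (hj.trans hi)
  have hs := scaledCount_block hu (hN i hi)
  rw [e] at hs
  have hcw := tendsto_nhds_unique (hw i) (hc.congr fun n ↦ (hs n).symm)
  rw [hcw]
  exact ⟨hc0 (hN i hi), hc⟩

omit [IsProbabilityMeasure P] in
lemma measurable_root (j : ℕ) : Measurable fun ω ↦ root (u · ω) (ε · ω) t j :=
  RecursiveTree.measurable_root (n := j) (fun k _ ↦ h.measurable_parent k)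
    (fun k _ ↦ h.measurable_clock k) t le_rfl

lemma aemeasurable_weight (i : ℕ) : AEMeasurable (fun ω ↦ weight (u · ω) (ε · ω) t i) P := by
  have hcount (v : ℕ) : Measurable fun ω ↦
      Nat.count (fun j ↦ root (u · ω) (ε · ω) t j = j) v := by
    simp only [Nat.count_eq_card_filter_range, Finset.card_filter]
    exact Finset.measurable_sum _ fun j _ ↦ Measurable.ite
      (h.measurable_root t j (measurableSet_singleton j)) measurable_const measurable_const
  have hrank (j : ℕ) : Measurable fun ω ↦
      Nat.count (fun j ↦ root (u · ω) (ε · ω) t j = j) (root (u · ω) (ε · ω) t j) :=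
    (measurable_from_prod_countable_right (f := fun q : ℕ × Ω ↦
      Nat.count (fun j ↦ root (u · q.2) (ε · q.2) t j = j) q.1) hcount).comp
      ((h.measurable_root t j).prodMk measurable_id)
  refine aemeasurable_of_tendsto_metrizable_ae atTop (fun n ↦ ?_) (h.ae_tendsto_scaledCount t i)
  have hn : Measurable fun ω ↦ (n : ℝ) ^ (-Real.exp (-(t : ℝ))) * ((∑ j ∈ Finset.range n,
      if Nat.count (fun j ↦ root (u · ω) (ε · ω) t j = j) (root (u · ω) (ε · ω) t j) = i
        then 1 else 0 : ℕ) : ℝ) :=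
    (measurable_from_nat.comp (Finset.measurable_sum _ fun j _ ↦ Measurable.ite
      (hrank j (measurableSet_singleton i)) measurable_const measurable_const)).const_mul _
  refine ⟨_, hn, ?_⟩
  filter_upwards [h.ae_parent_le] with ω hu
  rw [scaledCount, Nat.count_eq_card_filter_range, Finset.card_filter]
  simp only [mem_block_iff hu]

end IsDestruction

/-- The `i θ`-th power of a block size, renormalised. -/
lemma tendsto_risingRatio_mul_exp {p x θ : ℝ} (hp : 0 < p) (hx : 0 < x) {S : ℕ → ℕ}
    (hS : Tendsto (fun n : ℕ ↦ (n : ℝ) ^ (-p) * S n) atTop (𝓝 x)) :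
    Tendsto (fun n : ℕ ↦ risingRatio (Complex.I * θ) (S n) *
        Complex.exp (-(Complex.I * θ * (p * Real.log n)))) atTop
      (𝓝 ((Complex.Gamma (1 + Complex.I * θ))⁻¹ * Complex.exp (Complex.I * θ * Real.log x))) := by
  -- Positivity of x forces S → ∞, so the asymptotics of the rising ratio can be used along S.
  have hSinf : Tendsto S atTop atTop := by
    rw [← tendsto_natCast_atTop_iff (R := ℝ)]
    refine (((tendsto_rpow_atTop hp).comp tendsto_natCast_atTop_atTop).atTop_mul_pos hx hS).congr' ?_
    filter_upwards [eventually_gt_atTop 0] with n hn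
    have hn0 : (0 : ℝ) < n := by exact_mod_cast hn
    rw [Function.comp_apply, ← mul_assoc, ← Real.rpow_add hn0, add_neg_cancel, Real.rpow_zero,
      one_mul]
  have h1 := (tendsto_risingRatio (z := Complex.I * θ) (by simp)).comp hSinf
  have h2 : Tendsto (fun n : ℕ ↦ Complex.exp (Complex.I * θ *
      (Real.log ((n : ℝ) ^ (-p) * S n) : ℝ))) atTop
      (𝓝 (Complex.exp (Complex.I * θ * Real.log x))) :=
    (((Complex.continuous_ofReal.tendsto _).comp (hS.log hx.ne')).const_mul _).cexp
  -- The factors S^{-iθ} and (n^{-p} S)^{iθ} multiply to n^{-ipθ}.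
  refine (h1.mul h2).congr' ?_
  filter_upwards [eventually_gt_atTop 0, hSinf.eventually_gt_atTop 0] with n hn hSn
  have hn0 : (0 : ℝ) < n := by exact_mod_cast hn
  have hS0 : (0 : ℝ) < S n := by exact_mod_cast hSn
  have hSc : (S n : ℂ) ≠ 0 := by exact_mod_cast hSn.ne'
  rw [Function.comp_apply, Complex.cpow_def_of_ne_zero hSc, Complex.natCast_log, mul_assoc,
    ← Complex.exp_add, Real.log_mul (Real.rpow_pos_of_pos hn0 _).ne' hS0.ne', Real.log_rpow hn0]
  congr 2
  push_cast
  ring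

/-- Since |n^{-iθ}| = 1, the convergent renormalised ratio has the same modulus. This bound supplies
the dominating constant for passing to the limit in the expectations. -/
lemma exists_norm_risingRatio_le (θ : ℝ) :
    ∃ C, ∀ n, ‖risingRatio (Complex.I * θ) n‖ ≤ C := by
  obtain ⟨C, hC⟩ := (tendsto_risingRatio (z := Complex.I * θ) (by simp)).norm.bddAbove_range
  refine ⟨max C 0, fun n ↦ ?_⟩
  rcases Nat.eq_zero_or_pos n with rfl | hn
  · simp [risingRatio_zero_right]
  · refine le_trans ?_ (le_max_left _ _)
    have := hC ⟨n, rfl⟩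
    simp only [norm_mul] at this
    rwa [Complex.norm_natCast_cpow_of_pos hn, show (-(Complex.I * (θ : ℂ))).re = 0 by simp,
      Real.rpow_zero, mul_one] at this

/-! ### The joint Mellin transform on the separation event -/

namespace IsDestruction

variable {Ω : Type*} [mΩ : MeasurableSpace Ω] {P : Measure Ω} [IsProbabilityMeasure P]
  {u : ℕ → Ω → ℕ} {ε : ℕ → Ω → ℝ} (h : IsDestruction P u ε) (t : ℝ≥0)

variable (u ε) in
/-- The event that the first `N` vertices are in distinct blocks. -/
def separated (N : ℕ) : Set Ω := {ω | ∀ j < N, root (u · ω) (ε · ω) t j = j}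

include h

omit [IsProbabilityMeasure P] in
lemma measurableSet_separated (N : ℕ) : MeasurableSet (separated u ε t N) := by
  simp only [separated, Set.ofPred_forall]
  exact MeasurableSet.iInter fun j ↦ MeasurableSet.iInter fun _ ↦
    h.measurable_root t j (measurableSet_singleton j)

/-- The joint Mellin transform of the weights of the first blocks. -/
lemma setIntegral_exp_log_weight {N : ℕ} (hN : N ≠ 0) (θ : ℕ → ℝ) :
    (∫ ω in separated u ε t N, Complex.exp (Complex.I *
        ∑ i ∈ Finset.range N, θ i * Real.log (weight (u · ω) (ε · ω) t i)) ∂P) *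
      risingRatio (Complex.I * (Real.exp (-t) * ∑ i ∈ Finset.range N, θ i : ℝ)) N =
    P.real (separated u ε t N) *
      (Complex.Gamma (1 + Complex.I * (Real.exp (-t) * ∑ i ∈ Finset.range N, θ i : ℝ)))⁻¹ *
      ∏ i ∈ Finset.range N, Complex.Gamma (1 + Complex.I * θ i) := by
  set I := Finset.range N
  set A := separated u ε t N
  set w : ℝ := Real.exp (-t) * ∑ i ∈ I, θ i
  have hA : MeasurableSet A := h.measurableSet_separated t N
  have hIN : ∀ i ∈ I, i ≤ N - 1 := fun i hi ↦ by
    have := Finset.mem_range.1 hi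
    omega
  let Z (n : ℕ) (ω : Ω) : ℂ := sizeProd I (fun i ↦ Complex.I * θ i) (u · ω) (ε · ω) t n
  have hw : ((Real.exp (-t) : ℝ) : ℂ) * ∑ i ∈ I, Complex.I * θ i = Complex.I * w := by
    rw [← Finset.mul_sum]
    push_cast [w]
    ring
  have hZ0 : ∀ᵐ ω ∂P, ω ∉ A → ∀ n, Z n ω = 0 := by
    filter_upwards [h.ae_parent_le] with ω hu hωA n
    simp only [A, separated, Set.mem_ofPred_eq, not_forall] at hωA
    obtain ⟨j, hj, hjr⟩ := hωA
    exact sizeProd_eq_zero _ (Finset.mem_range.2 hj) (size_eq_zero hu hjr n)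
  -- On `A` each block has exactly one of the first N vertices and the rising ratio at 1 is 1; off
  -- `A` some factor is 0. So `Z N` is almost surely the indicator of `A`.
  have hZN : ∫ ω, Z N ω ∂P = P.real A := by
    have : ∫ ω, Z N ω ∂P = ∫ ω, A.indicator (fun _ ↦ (1 : ℂ)) ω ∂P := by
      refine integral_congr_ae ?_
      filter_upwards [hZ0] with ω hω
      by_cases hωA : ω ∈ A
      · rw [Set.indicator_of_mem hωA]
        refine Finset.prod_eq_one fun i hi ↦ ?_
        rw [size_of_forall_root_eq hωA (Finset.mem_range.1 hi), risingRatio_one]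
      · rw [Set.indicator_of_notMem hωA, hω hωA]
    rw [this, integral_indicator hA, setIntegral_const]
    simp
  have hexp (n : ℕ) (hn : n ≠ 0) (s : ℂ) : (n : ℂ) ^ (-s) = Complex.exp (-(s * Real.log n)) := by
    rw [Complex.cpow_def_of_ne_zero (by exact_mod_cast hn), Complex.natCast_log]
    congr 1
    ring
  -- the renormalised expectations are explicit
  have hE {n : ℕ} (hn : N ≤ n) : (∫ ω, Z n ω * Complex.exp (-(Complex.I * w * Real.log n)) ∂P) *
      risingRatio (Complex.I * w) N =
      P.real A * (risingRatio (Complex.I * w) n * (n : ℂ) ^ (-(Complex.I * w))) := by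
    have := h.integral_sizeProd t I (fun i ↦ Complex.I * θ i) (N := N - 1) (n := n - 1) hIN
      (by omega)
    rw [Nat.sub_add_cancel (by omega), Nat.sub_add_cancel (by omega)] at this
    simp only [RCLike.ofReal_eq_complex_ofReal] at this
    rw [hw] at this
    change (∫ ω, Z n ω ∂P) * _ = (∫ ω, Z N ω ∂P) * _ at this
    rw [hZN] at this
    rw [integral_mul_const, hexp n (by omega)]
    linear_combination Complex.exp (-(Complex.I * w * Real.log n)) * this
  have hlim1 : Tendsto (fun n ↦ (∫ ω, Z n ω * Complex.exp (-(Complex.I * w * Real.log n)) ∂P) *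
      risingRatio (Complex.I * w) N) atTop
      (𝓝 (P.real A * (Complex.Gamma (1 + Complex.I * w))⁻¹)) := by
    refine ((tendsto_risingRatio (z := Complex.I * w) (by simp)).const_mul _).congr' ?_
    filter_upwards [eventually_ge_atTop N] with n hn
    exact (hE hn).symm
  -- dominated convergence
  choose C hC using fun i ↦ exists_norm_risingRatio_le (θ i)
  have hlim2 : Tendsto (fun n ↦ ∫ ω, Z n ω * Complex.exp (-(Complex.I * w * Real.log n)) ∂P) atTop
      (𝓝 (∫ ω, A.indicator (fun ω ↦ (∏ i ∈ I, (Complex.Gamma (1 + Complex.I * θ i))⁻¹) *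
        Complex.exp (Complex.I * ∑ i ∈ I, θ i * Real.log (weight (u · ω) (ε · ω) t i))) ω ∂P)) := by
    rw [← tendsto_add_atTop_iff_nat 1]
    refine tendsto_integral_of_dominated_convergence (fun _ ↦ ∏ i ∈ I, C i) (fun n ↦ ?_)
      (integrable_const _) (fun n ↦ ae_of_all _ fun ω ↦ ?_) ?_
    · exact (((h.measurable_sizeProd_past t I _ n).mono (h.past.le n) le_rfl).mul_const
        _).aestronglyMeasurable
    · rw [norm_mul, show -(Complex.I * w * Real.log (n + 1 : ℕ)) =
        ((-(w * Real.log (n + 1 : ℕ)) : ℝ) : ℂ) * Complex.I by push_cast; ring,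
        Complex.norm_exp_ofReal_mul_I, mul_one]
      simp only [Z, sizeProd]
      rw [norm_prod]
      exact Finset.prod_le_prod (fun _ _ ↦ norm_nonneg _) fun i _ ↦ hC i _
    · filter_upwards [hZ0, h.ae_tendsto_size t N] with ω hω hX
      rw [tendsto_add_atTop_iff_nat (f := fun n ↦ Z n ω *
        Complex.exp (-(Complex.I * w * Real.log n))) 1]
      by_cases hωA : ω ∈ A
      · rw [Set.indicator_of_mem hωA, Complex.ofReal_sum, Finset.mul_sum, Complex.exp_sum,
          ← Finset.prod_mul_distrib]
        have := tendsto_finsetProd I fun i hi ↦ tendsto_risingRatio_mul_exp (θ := θ i)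
          (Real.exp_pos (-(t : ℝ))) (hX hωA i (Finset.mem_range.1 hi)).1
          (hX hωA i (Finset.mem_range.1 hi)).2
        simp only [Complex.ofReal_mul, mul_assoc] at this ⊢
        refine this.congr fun n ↦ ?_
        rw [Finset.prod_mul_distrib, ← Complex.exp_sum]
        congr 2
        rw [Finset.sum_neg_distrib, ← Finset.mul_sum, ← Finset.sum_mul]
        push_cast [w]
        ring
      · rw [Set.indicator_of_notMem hωA]
        simp [hω hωA]
  have := tendsto_nhds_unique (hlim2.mul_const (risingRatio (Complex.I * w) N)) hlim1
  rw [integral_indicator hA, integral_const_mul, Finset.prod_inv_distrib] at this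
  have hG : ∏ i ∈ I, Complex.Gamma (1 + Complex.I * θ i) ≠ 0 :=
    Finset.prod_ne_zero_iff.2 fun i _ ↦ Complex.Gamma_ne_zero_of_re_pos (by simp)
  rw [← this]
  field_simp

/-- A vertex that is not a top has an uncut edge to its parent; a union bound over the clocks
suffices. -/
lemma measure_separated_compl_le (N : ℕ) :
    P.real (separated u ε t N)ᶜ ≤ N * Real.exp (-t) := by
  have hsub : (separated u ε t N)ᶜ ⊆ ⋃ k ∈ Finset.range N, {ω | (t : ℝ) < ε k ω} := by
    intro ω hω
    simp only [separated, Set.mem_compl_iff, Set.mem_ofPred_eq, not_forall] at hω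
    obtain ⟨j, hj, hjr⟩ := hω
    cases j with
    | zero => exact absurd root_zero hjr
    | succ k =>
      simp only [Set.mem_iUnion, Set.mem_ofPred_eq]
      exact ⟨k, Finset.mem_range.2 (by omega), not_le.1 fun hk ↦ hjr (root_succ_of_le hk)⟩
  refine (measureReal_mono hsub (measure_ne_top _ _)).trans
    ((measureReal_biUnion_finset_le _ _).trans ?_)
  simp [h.measure_lt_clock]

lemma tendsto_measure_separated_compl (N : ℕ) :
    Tendsto (fun t ↦ P.real (separated u ε t N)ᶜ) atTop (𝓝 0) := by
  have : Tendsto (fun t : ℝ≥0 ↦ N * Real.exp (-t)) atTop (𝓝 0) := by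
    simpa using (Real.tendsto_exp_neg_atTop_nhds_zero.comp
      (NNReal.tendsto_coe_atTop.2 tendsto_id)).const_mul (N : ℝ)
  exact squeeze_zero (fun _ ↦ measureReal_nonneg)
    (fun t ↦ h.measure_separated_compl_le t N) this

end IsDestruction

end RecursiveTree

/-! ### Criteria for convergence in distribution -/

section ConvergenceInDistribution

variable {ι Ω Ω' : Type*} [MeasurableSpace Ω] {P : Measure Ω} [IsProbabilityMeasure P]
  [MeasurableSpace Ω'] {P' : Measure Ω'} [IsProbabilityMeasure P']
  {l : Filter ι} [l.IsCountablyGenerated]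

/-- Pointwise convergence of characteristic functions implies convergence in distribution. -/
lemma MeasureTheory.tendstoInDistribution_of_tendsto_charFun {E : Type*} [NormedAddCommGroup E]
    [InnerProductSpace ℝ E] [FiniteDimensional ℝ E] [MeasurableSpace E] [BorelSpace E]
    {X : ι → Ω → E} {Z : Ω' → E} (hX : ∀ i, AEMeasurable (X i) P) (hZ : AEMeasurable Z P')
    (h : ∀ x, Tendsto (fun i ↦ charFun (P.map (X i)) x) l (𝓝 (charFun (P'.map Z) x))) :
    TendstoInDistribution X l Z (fun _ ↦ P) P' where
  forall_aemeasurable := hX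
  aemeasurable_limit := hZ
  tendsto := tendsto_of_seq_tendsto fun _ hs ↦
    ProbabilityMeasure.tendsto_iff_tendsto_charFun.2 fun x ↦ (h x).comp hs

/-- Setting all coordinates from `N` on to zero. -/
def truncate (N : ℕ) (x : ℕ → ℝ) : ℕ → ℝ := fun k ↦ if k < N then x k else 0

lemma continuous_truncate (N : ℕ) : Continuous (truncate N) := by
  refine continuous_pi fun k ↦ ?_
  by_cases hk : k < N
  · simpa [truncate, hk] using continuous_apply k
  · simpa [truncate, hk] using continuous_const

/-- An entourage of the product constrains only finitely many coordinates, so the convergence is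
uniform over all sequences and no tightness argument is needed. -/
lemma tendstoUniformly_truncate : TendstoUniformly truncate id atTop := by
  rw [tendstoUniformly_iff_tendsto, Pi.uniformity, tendsto_iInf]
  refine fun k ↦ tendsto_comap_iff.2 fun s hs ↦ ?_
  have : ∀ᶠ q : ℕ × (ℕ → ℝ) in atTop ×ˢ ⊤, k < q.1 := (eventually_gt_atTop k).prod_inl ⊤
  rw [mem_map]
  filter_upwards [this] with q hq
  rw [Set.mem_preimage]
  simp only [Function.comp_apply, truncate, if_pos hq, id]
  exact refl_mem_uniformity hs

/-- If `f ∘ g` is uniformly close to `f`, then so are the integrals. -/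
lemma MeasureTheory.dist_integral_map_comp_le {E : Type*} [MeasurableSpace E] {f : E → ℝ}
    (hf : Measurable f) {g : E → E} (hg : Measurable g) {C δ : ℝ} (hC : ∀ x, ‖f x‖ ≤ C)
    (h : ∀ x, dist (f x) (f (g x)) ≤ δ) {Y : Ω → E} (hY : AEMeasurable Y P) :
    dist (∫ x, f x ∂(P.map Y)) (∫ x, f x ∂(P.map fun ω ↦ g (Y ω))) ≤ δ := by
  have hY' : AEMeasurable (fun ω ↦ g (Y ω)) P := hg.comp_aemeasurable hY
  have hi {Y : Ω → E} (hY : AEMeasurable Y P) : Integrable (fun ω ↦ f (Y ω)) P :=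
    Integrable.of_bound (hf.comp_aemeasurable hY).aestronglyMeasurable _ (ae_of_all _ fun ω ↦ hC _)
  rw [integral_map hY hf.aestronglyMeasurable, integral_map hY' hf.aestronglyMeasurable,
    dist_eq_norm, ← integral_sub (hi hY) (hi hY')]
  refine (norm_integral_le_of_norm_le_const (C := δ) (ae_of_all _ fun ω ↦ ?_)).trans (by simp)
  rw [← dist_eq_norm]
  exact h (Y ω)

/-- Convergence in distribution in `ℕ → ℝ` follows from that of the truncated sequences. -/
lemma MeasureTheory.tendstoInDistribution_of_truncate {X : ι → Ω → ℕ → ℝ} {Z : Ω' → ℕ → ℝ}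
    (hX : ∀ i, AEMeasurable (X i) P) (hZ : AEMeasurable Z P')
    (h : ∀ N ≠ 0, TendstoInDistribution (fun i ω ↦ truncate N (X i ω)) l
      (fun ω ↦ truncate N (Z ω)) (fun _ ↦ P) P') :
    TendstoInDistribution X l Z (fun _ ↦ P) P' where
  forall_aemeasurable := hX
  aemeasurable_limit := hZ
  tendsto := by
    let : PseudoMetricSpace (ℕ → ℝ) := PiCountable.pseudoMetricSpace
    refine tendsto_iff_forall_lipschitz_integral_tendsto.2 ?_
    rintro f ⟨C, hC⟩ ⟨L, hL⟩
    have hfc : Continuous f := hL.continuous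
    have hfm : Measurable f := hfc.measurable
    have hbound (x : ℕ → ℝ) : ‖f x‖ ≤ ‖f 0‖ + C := by
      have h1 := hC x 0
      have h2 := norm_sub_norm_le (f x) (f 0)
      rw [dist_eq_norm] at h1
      linarith
    simp only [ProbabilityMeasure.coe_mk]
    rw [Metric.tendsto_nhds]
    intro δ hδ
    -- Bounded Lipschitz functions for a metric of the product suffice as tests; δ / 3 pays for each
    -- of the two truncations and for the convergence at fixed N.
    have hU := Metric.tendstoUniformly_iff.1
      (hL.uniformContinuous.comp_tendstoUniformly tendstoUniformly_truncate) (δ / 3) (by positivity)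
    obtain ⟨N, hN, hN0⟩ := (hU.and (eventually_ne_atTop 0)).exists
    have hlim := (tendsto_iff_forall_lipschitz_integral_tendsto.1 (h N hN0).tendsto) f
      ⟨C, hC⟩ ⟨L, hL⟩
    filter_upwards [(Metric.tendsto_nhds.1 hlim) (δ / 3) (by positivity)] with i hi
    have h1 := dist_integral_map_comp_le hfm (continuous_truncate N).measurable hbound
      (fun x ↦ (hN x).le) (hX i)
    have h2 := dist_integral_map_comp_le hfm (continuous_truncate N).measurable hbound
      (fun x ↦ (hN x).le) hZ
    rw [dist_comm] at h2
    simp only [ProbabilityMeasure.coe_mk] at hi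
    have h3 := dist_triangle4 (∫ x, f x ∂(P.map (X i)))
      (∫ x, f x ∂(P.map fun ω ↦ truncate N (X i ω)))
      (∫ x, f x ∂(P'.map fun ω ↦ truncate N (Z ω))) (∫ x, f x ∂(P'.map Z))
    linarith

end ConvergenceInDistribution

/-- The Mellin transform of the standard exponential law on the line `1 + i ℝ`. -/
lemma ProbabilityTheory.integral_exp_log_expMeasure (θ : ℝ) :
    ∫ x, Complex.exp (Complex.I * (θ * Real.log x : ℝ)) ∂(expMeasure 1) =
      Complex.Gamma (1 + Complex.I * θ) := by
  have hE : expMeasure 1 = volume.withDensity (exponentialPDF 1) := rfl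
  have hm : Measurable (exponentialPDF 1) :=
    (measurable_exponentialPDFReal 1).ennreal_ofReal
  rw [hE, integral_withDensity_eq_integral_toReal_smul hm
    (ae_of_all _ fun x ↦ ENNReal.ofReal_lt_top), Complex.Gamma_eq_integral (by simp),
    Complex.GammaIntegral, ← integral_indicator measurableSet_Ioi]
  refine integral_congr_ae ?_
  filter_upwards [Measure.ae_ne volume (0 : ℝ)] with x hx
  rcases lt_or_gt_of_ne hx with h | h
  · rw [exponentialPDF_of_neg h, Set.indicator_of_notMem (by simpa using h.le)]
    simp
  · rw [exponentialPDF_of_nonneg h.le, Set.indicator_of_mem (Set.mem_Ioi.2 h),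
      ENNReal.toReal_ofReal (by positivity), add_sub_cancel_left,
      Complex.cpow_def_of_ne_zero (by exact_mod_cast hx), ← Complex.ofReal_log h.le,
      Complex.real_smul, one_mul, one_mul]
    congr 2
    push_cast
    ring

lemma ProbabilityTheory.ae_pos_expMeasure : ∀ᵐ x ∂(expMeasure 1), 0 < x := by
  have hE : expMeasure 1 = volume.withDensity (exponentialPDF 1) := rfl
  have hm : Measurable (exponentialPDF 1) :=
    (measurable_exponentialPDFReal 1).ennreal_ofReal
  rw [hE, ae_withDensity_iff hm]
  filter_upwards [Measure.ae_ne volume (0 : ℝ)] with x hx hpdf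
  rcases lt_or_gt_of_ne hx with h | h
  · exact absurd (exponentialPDF_of_neg h) hpdf
  · exact h

/-! ### From the Mellin transform to convergence of the weights -/

namespace RecursiveTree

/-- The logarithms of the first `N` coordinates, as a Euclidean vector. -/
noncomputable def logVector (N : ℕ) (x : ℕ → ℝ) : EuclideanSpace ℝ (Fin N) :=
  WithLp.toLp 2 fun i ↦ Real.log (x i)

/-- The first `N` coordinates, as a Euclidean vector. -/
noncomputable def initialVector (N : ℕ) (x : ℕ → ℝ) : EuclideanSpace ℝ (Fin N) :=
  WithLp.toLp 2 fun i ↦ x i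

/-- The coordinatewise exponential. -/
noncomputable def expVector {N : ℕ} (x : EuclideanSpace ℝ (Fin N)) : EuclideanSpace ℝ (Fin N) :=
  WithLp.toLp 2 fun i ↦ Real.exp (x i)

lemma measurable_logVector (N : ℕ) : Measurable (logVector N) := by
  unfold logVector
  fun_prop

lemma measurable_initialVector (N : ℕ) : Measurable (initialVector N) := by
  unfold initialVector
  fun_prop

lemma continuous_expVector {N : ℕ} : Continuous (expVector (N := N)) := by
  unfold expVector
  fun_prop

lemma expVector_logVector {N : ℕ} {x : ℕ → ℝ} (hx : ∀ i < N, 0 < x i) :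
    expVector (logVector N x) = initialVector N x := by
  ext i
  simp [expVector, logVector, initialVector, Real.exp_log (hx i i.2)]

/-- The continuous extension of a vector by zero. -/
def extendVector {N : ℕ} (x : EuclideanSpace ℝ (Fin N)) : ℕ → ℝ :=
  fun k ↦ if hk : k < N then x ⟨k, hk⟩ else 0

lemma continuous_extendVector {N : ℕ} : Continuous (extendVector (N := N)) := by
  refine continuous_pi fun k ↦ ?_
  by_cases hk : k < N
  · simp only [extendVector, hk, dif_pos]
    fun_prop
  · simpa [extendVector, hk] using continuous_const

lemma extendVector_initialVector (N : ℕ) (x : ℕ → ℝ) :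
    extendVector (initialVector N x) = truncate N x := by
  funext k
  by_cases hk : k < N <;> simp [extendVector, initialVector, truncate, hk]

lemma charFun_map_logVector {Ω : Type*} [MeasurableSpace Ω] {P : Measure Ω} {X : Ω → ℕ → ℝ}
    (hX : AEMeasurable X P) {N : ℕ} (x : EuclideanSpace ℝ (Fin N)) :
    charFun (P.map fun ω ↦ logVector N (X ω)) x = ∫ ω, Complex.exp (Complex.I *
      (∑ i ∈ Finset.range N, extendVector x i * Real.log (X ω i) : ℝ)) ∂P := by
  have hm : AEMeasurable (fun ω ↦ logVector N (X ω)) P :=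
    (measurable_logVector N).comp_aemeasurable hX
  rw [charFun_apply, integral_map hm (by fun_prop)]
  refine integral_congr_ae (ae_of_all _ fun ω ↦ ?_)
  simp only
  rw [mul_comm, Finset.sum_range]
  congr 4
  rw [PiLp.inner_apply]
  refine Finset.sum_congr rfl fun i _ ↦ ?_
  simp [logVector, extendVector]

lemma charFun_map_logVector_of_iIndepFun {Ω : Type*} [MeasurableSpace Ω] {P : Measure Ω}
    [IsProbabilityMeasure P] {W : ℕ → Ω → ℝ} (hW : iIndepFun W P)
    (hlaw : ∀ i, HasLaw (W i) (expMeasure 1) P) {N : ℕ} (x : EuclideanSpace ℝ (Fin N)) :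
    charFun (P.map fun ω ↦ logVector N (W · ω)) x =
      ∏ i ∈ Finset.range N, Complex.Gamma (1 + Complex.I * extendVector x i) := by
  rw [charFun_map_logVector (aemeasurable_pi_iff.2 fun i ↦ (hlaw i).aemeasurable),
    Finset.prod_range]
  have e (ω : Ω) : Complex.exp (Complex.I *
      (∑ i ∈ Finset.range N, extendVector x i * Real.log (W i ω) : ℝ)) =
      ∏ i : Fin N, Complex.exp (Complex.I * (extendVector x i * Real.log (W i ω) : ℝ)) := by
    rw [← Complex.exp_sum, ← Finset.mul_sum, Finset.sum_range]
    push_cast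
    rfl
  simp only [e]
  have hW' : iIndepFun (fun i : Fin N ↦ W i) P := hW.precomp Fin.val_injective
  have hmeas (i : Fin N) : Measurable fun y : ℝ ↦
      Complex.exp (Complex.I * (extendVector x i * Real.log y : ℝ)) := by
    fun_prop
  rw [hW'.integral_fun_prod_comp (X := fun i : Fin N ↦ W i) (f := fun i y ↦
    Complex.exp (Complex.I * (extendVector x i * Real.log y : ℝ)))
    (fun i ↦ (hlaw i).aemeasurable) fun i ↦ (hmeas i).aestronglyMeasurable]
  refine Finset.prod_congr rfl fun i _ ↦ ?_
  rw [← integral_exp_log_expMeasure, ← (hlaw i).map_eq, integral_map (hlaw i).aemeasurable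
    (hmeas i).aestronglyMeasurable]

namespace IsDestruction

variable {Ω : Type*} [mΩ : MeasurableSpace Ω] {P : Measure Ω} [IsProbabilityMeasure P]
  {u : ℕ → Ω → ℕ} {ε : ℕ → Ω → ℝ} (h : IsDestruction P u ε)
include h

lemma aemeasurable_weights (t : ℝ≥0) :
    AEMeasurable (fun ω i ↦ weight (u · ω) (ε · ω) t i) P :=
  aemeasurable_pi_iff.2 (h.aemeasurable_weight t)

/-- In `setIntegral_exp_log_weight` the quantity e^{-t} ∑ θ_i tends to 0, so its rising ratio and
its Gamma factor tend to 1, as does the probability of separation. -/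
lemma tendsto_setIntegral_exp_log_weight {N : ℕ} (hN : N ≠ 0) (θ : ℕ → ℝ) :
    Tendsto (fun t : ℝ≥0 ↦ ∫ ω in separated u ε t N, Complex.exp (Complex.I *
        (∑ i ∈ Finset.range N, θ i * Real.log (weight (u · ω) (ε · ω) t i) : ℝ)) ∂P) atTop
      (𝓝 (∏ i ∈ Finset.range N, Complex.Gamma (1 + Complex.I * θ i))) := by
  have hw : Tendsto (fun t : ℝ≥0 ↦ Complex.I *
      (Real.exp (-t) * ∑ i ∈ Finset.range N, θ i : ℝ)) atTop (𝓝 0) := by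
    have : Tendsto (fun t : ℝ≥0 ↦ Real.exp (-t) * ∑ i ∈ Finset.range N, θ i) atTop (𝓝 0) := by
      simpa using (Real.tendsto_exp_neg_atTop_nhds_zero.comp
        (NNReal.tendsto_coe_atTop.2 tendsto_id)).mul_const (∑ i ∈ Finset.range N, θ i)
    simpa using ((Complex.continuous_ofReal.tendsto _).comp this).const_mul Complex.I
  have hf := ((continuous_risingRatio (𝕜 := ℂ) N).tendsto 0).comp hw
  rw [risingRatio_zero_left hN] at hf
  have hG : Tendsto Complex.Gamma (𝓝 1) (𝓝 1) := by
    have := (Complex.differentiableAt_Gamma_one).continuousAt.tendsto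
    rwa [Complex.Gamma_one] at this
  have hG' := (hG.comp (by simpa only [add_zero] using hw.const_add 1)).inv₀ one_ne_zero
  have hA : Tendsto (fun t ↦ (P.real (separated u ε t N) : ℂ)) atTop (𝓝 1) := by
    have := (h.tendsto_measure_separated_compl N).const_sub 1
    simp only [sub_zero] at this
    refine ((Complex.continuous_ofReal.tendsto 1).comp this).congr fun t ↦ ?_
    rw [Function.comp_apply, probReal_compl_eq_one_sub (h.measurableSet_separated t N),
      sub_sub_cancel]
  have hmain := ((hA.mul hG').mul_const
    (∏ i ∈ Finset.range N, Complex.Gamma (1 + Complex.I * θ i))).mul (hf.inv₀ one_ne_zero)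
  simp only [inv_one, mul_one, one_mul] at hmain
  refine hmain.congr' ?_
  -- The explicit formula is multiplied by a rising ratio; its limit 1 allows division for large t.
  filter_upwards [hf.eventually_ne one_ne_zero] with t ht
  simp only [Function.comp_apply] at ht ⊢
  rw [← h.setIntegral_exp_log_weight t hN θ, mul_assoc, mul_inv_cancel₀ ht, mul_one]

variable {Ω' : Type*} [MeasurableSpace Ω'] {P' : Measure Ω'} [IsProbabilityMeasure P']
  {W : ℕ → Ω' → ℝ}

/-- The characteristic function integrates a function of modulus 1, so restricting it to `separated`
costs at most the probability of the complement. -/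
lemma tendstoInDistribution_logVector (hW : iIndepFun W P')
    (hlaw : ∀ i, HasLaw (W i) (expMeasure 1) P') {N : ℕ} (hN : N ≠ 0) :
    TendstoInDistribution (fun (t : ℝ≥0) ω ↦ logVector N (weight (u · ω) (ε · ω) t)) atTop
      (fun ω ↦ logVector N (W · ω)) (fun _ ↦ P) P' := by
  have hWm : AEMeasurable (fun ω i ↦ W i ω) P' :=
    aemeasurable_pi_iff.2 fun i ↦ (hlaw i).aemeasurable
  refine tendstoInDistribution_of_tendsto_charFun
    (fun t ↦ (measurable_logVector N).comp_aemeasurable (h.aemeasurable_weights t))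
    ((measurable_logVector N).comp_aemeasurable hWm) fun x ↦ ?_
  rw [charFun_map_logVector_of_iIndepFun hW hlaw]
  refine (tendsto_iff_of_dist ?_).1 (h.tendsto_setIntegral_exp_log_weight hN (extendVector x))
  refine squeeze_zero (fun _ ↦ dist_nonneg) (fun t ↦ ?_) (h.tendsto_measure_separated_compl N)
  rw [charFun_map_logVector (h.aemeasurable_weights t)]
  set F : Ω → ℂ := fun ω ↦ Complex.exp (Complex.I * (∑ i ∈ Finset.range N,
    extendVector x i * Real.log (weight (u · ω) (ε · ω) t i) : ℝ))
  have hF1 (ω : Ω) : ‖F ω‖ = 1 := by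
    simp only [F]
    rw [mul_comm, Complex.norm_exp_ofReal_mul_I]
  have hFm : AEMeasurable F P := by
    have := h.aemeasurable_weight t
    simp only [F]
    fun_prop
  have hFi : Integrable F P :=
    Integrable.of_bound hFm.aestronglyMeasurable 1 (ae_of_all _ fun ω ↦ (hF1 ω).le)
  rw [← integral_add_compl (h.measurableSet_separated t N) hFi, dist_comm, dist_eq_norm,
    add_sub_cancel_left]
  refine (norm_setIntegral_le_of_norm_le_const (measure_lt_top _ _)
    fun ω _ ↦ (hF1 ω).le).trans_eq (one_mul _)

/-- Exponentiating the logarithms recovers the weights only where they are positive, which almost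
surely holds on `separated`. Elsewhere the default value of `Real.log` may spoil the identity, but
the discrepancy tends to 0 in probability. -/
lemma tendstoInDistribution_initialVector (hW : iIndepFun W P')
    (hlaw : ∀ i, HasLaw (W i) (expMeasure 1) P') {N : ℕ} (hN : N ≠ 0) :
    TendstoInDistribution (fun (t : ℝ≥0) ω ↦ initialVector N (weight (u · ω) (ε · ω) t)) atTop
      (fun ω ↦ initialVector N (W · ω)) (fun _ ↦ P) P' := by
  have hWpos : ∀ᵐ ω ∂P', ∀ i, 0 < W i ω := by
    refine ae_all_iff.2 fun i ↦ ?_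
    have := ae_pos_expMeasure
    rw [← (hlaw i).map_eq] at this
    exact ae_of_ae_map (hlaw i).aemeasurable this
  have hexp := ((h.tendstoInDistribution_logVector hW hlaw hN).continuous_comp
    continuous_expVector).congr (fun _ ↦ EventuallyEq.rfl)
    (T := fun ω ↦ initialVector N (W · ω)) (by
      filter_upwards [hWpos] with ω hω
      exact expVector_logVector fun i _ ↦ hω i)
  refine tendstoInDistribution_of_tendstoInMeasure_sub _ _ hexp ?_
    fun t ↦ (measurable_initialVector N).comp_aemeasurable (h.aemeasurable_weights t)
  rw [tendstoInMeasure_iff_measureReal_norm]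
  intro δ hδ
  refine squeeze_zero (fun _ ↦ measureReal_nonneg) (fun t ↦ ?_)
    (h.tendsto_measure_separated_compl N)
  refine ENNReal.toReal_mono (measure_ne_top _ _) (measure_mono_ae ?_)
  filter_upwards [h.ae_tendsto_size t N] with ω hω hωδ hωA
  have := expVector_logVector (x := weight (u · ω) (ε · ω) t) fun i hi ↦ (hω hωA i hi).1
  change δ ≤ ‖initialVector N _ - expVector (logVector N _) - 0‖ at hωδ
  rw [this, sub_self, sub_zero, norm_zero] at hωδ
  exact hδ.not_ge hωδ

lemma tendstoInDistribution_weight (hW : iIndepFun W P')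
    (hlaw : ∀ i, HasLaw (W i) (expMeasure 1) P') :
    TendstoInDistribution (fun (t : ℝ≥0) ω i ↦ weight (u · ω) (ε · ω) t i) atTop
      (fun ω i ↦ W i ω) (fun _ ↦ P) P' := by
  refine tendstoInDistribution_of_truncate h.aemeasurable_weights
    (aemeasurable_pi_iff.2 fun i ↦ (hlaw i).aemeasurable) fun N hN ↦ ?_
  simp only [← extendVector_initialVector]
  exact (h.tendstoInDistribution_initialVector hW hlaw hN).continuous_comp continuous_extendVector

end IsDestruction

end RecursiveTree

theorem corollary2
    {Ω : Type*} [MeasurableSpace Ω] (P : Measure Ω) [IsProbabilityMeasure P]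
    (u : ℕ → Ω → ℕ) (ε : ℕ → Ω → ℝ) (h : RecursiveTree.IsDestruction P u ε)
    {Ω' : Type*} [MeasurableSpace Ω'] (P' : Measure Ω') [IsProbabilityMeasure P']
    (W : ℕ → Ω' → ℝ) (hW_indep : iIndepFun W P')
    (hW_law : ∀ i, HasLaw (W i) (expMeasure 1) P') :
    (∀ (t : ℝ≥0) (i : ℕ), ∀ᵐ ω ∂P,
      Tendsto
        (RecursiveTree.scaledCount
          (RecursiveTree.block (RecursiveTree.partition (u · ω) (ε · ω) t) i) t)
        atTop (𝓝 (RecursiveTree.weight (u · ω) (ε · ω) t i))) ∧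
    TendstoInDistribution
      (fun (t : ℝ≥0) (ω : Ω) (i : ℕ) ↦ RecursiveTree.weight (u · ω) (ε · ω) t i)
      atTop (fun (ω' : Ω') (i : ℕ) ↦ W i ω') (fun _ ↦ P) P' :=
  ⟨h.ae_tendsto_scaledCount, h.tendstoInDistribution_weight hW_indep hW_law⟩
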